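/- Let $f:\mathbb{R}^n\to\mathbb{R}$ be continuously differentiable with $f\ge f_{\min}$ for some $f_{\min}\in\mathbb{R}$, and let $1\le p\le n$. Vectors carry the Euclidean norm $\|\cdot\|$; the norms used for $n\times p$ and for $p\times p$ matrices are any fixed matrix norms consistent with it ($\|Av\|\le\|A\|\,\|v\|$). **Algorithm (STARS).** Fix $\gamma>1$, $\eta_1\in(0,1)$, $\eta_2>0$, $j_{\max}\in\mathbb{N}$, $\delta_0>0$, $\delta_{\max}=\gamma^{j_{\max}}\delta_0$, $x_0\in\mathbb{R}^n$ and $\kappa_{fcd}\in(0,1]$. On a probability space $(\Omega,\mathcal F,\mathbb P)$, iteration $k=0,1,2,\dots$ generates a random matrix $Q_k\in\mathbb{R}^{n\times p}$, a random quadratic model $\hat m_k(s)=c_k+\hat g_k^\top s+s^\top\hat H_ks$ on $\mathbb{R}^p$ ($\hat H_k$ symmetric), a trial step $s_k\in\mathbb{R}^p$ and random estimates $f_k^0,f_k^s\in\mathbb{R}$ of $f(x_k)$ and $f(x_k+Q_ks_k)$. For all realizations $\|s_k\|\le\delta_k$ and $$\hat m_k(0)-\hat m_k(s_k)\ge\frac{\kappa_{fcd}}2\|\hat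 g_k\|\min\Big\{\delta_k,\frac{\|\hat g_k\|}{\max(\|\hat H_k\|,1)}\Big\}.$$ With $\rho_k=\dfrac{f_k^0-f_k^s}{\hat m_k(0)-\hat m_k(s_k)}$: if $\rho_k\ge\eta_1$ and $\|\hat g_k\|\ge\eta_2\delta_k$, then $x_{k+1}=x_k+Q_ks_k$ and $\delta_{k+1}=\min\{\gamma\delta_k,\delta_{\max}\}$; otherwise $x_{k+1}=x_k$ and $\delta_{k+1}=\gamma^{-1}\delta_k$. Let $\mathcal F_{k-1}=\sigma(f_\ell^0,f_\ell^s,\hat m_\ell,Q_\ell:\ 0\le\ell\le k-1)$ (trivial for $k=0$), $\mathcal F_{k-1}^Q=\mathcal F_{k-1}\vee\sigma(Q_k)$ and $\mathcal F_{k-1}^{\hat m\cdot Q}=\mathcal F_{k-1}^Q\vee\sigma(\hat m_k)$. The step $s_k$ is $\mathcal F_{k-1}^{\hat m\cdot Q}$-measurable. **Assumptions.** 1. For all $k$ and all realizations, $\|Q_k\|\le Q_{\max}$ and $\|\hat H_k\|\le\kappa_h$, for constants $Q_{\max}>0$ and $\kappa_h\ge1$. 2. $f$ is Lipschitz continuous,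 and $\nabla f$ is Lipschitz continuous with constant $L_g$, on the union over all realizations and all $k$ of the sets $\{x_k+Q_ks:\|s\|\le\delta_{\max}\}$. 3. For constants $\kappa_{ef},\kappa_{eg}>0$ and $\beta_m\in(0,1)$, the models are $\beta_m$-probabilistically $(\kappa_{ef},\kappa_{eg};Q_k)$-fully linear: for all $k$, almost surely $\mathbb P(I_k\mid\mathcal F^Q_{k-1})\ge\beta_m$, where $I_k$ is the event that for all $s\in\mathbb{R}^p$ with $\|s\|\le\delta_k$, $|f(x_k+Q_ks)-\hat m_k(s)|\le\kappa_{ef}\delta_k^2$ and $\|Q_k^\top\nabla f(x_k+Q_ks)-\nabla\hat m_k(s)\|\le\kappa_{eg}\delta_k$. 4. For constants $\beta_f\in(0,1)$ and $0<\varepsilon_f<\min\{\kappa_{ef},\tfrac14\eta_1\eta_2\kappa_{fcd}\min\{\tfrac{\eta_2}{\kappa_h},1\}\}$, the estimates are $\beta_f$-probabilistically $\varepsilon_f$-accurate: for all $k$, almost surely $\mathbb P(J_k\mid\mathcal F^{\hat m\cdot Q}_{k-1})\ge\beta_f$, where $J_k$ is the event that $|f_k^0-f(x_k)|\le\varepsilon_f\delta_k^2$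 and $|f_k^s-f(x_k+Q_ks_k)|\le\varepsilon_f\delta_k^2$. 5. There are constants $\zeta>0$ and $\nu\in(0,1)$ with $$\zeta\ge\kappa_{eg}+\max\Big\{\eta_2,\kappa_h,\frac{8\kappa_{ef}}{\kappa_{fcd}(1-\eta_1)}\Big\},\qquad \frac{\nu}{1-\nu}\ge\frac{8\gamma^2}{\min\{C_2,\zeta C_1\}},$$ $$\frac{\beta_f\beta_m-\frac12}{(1-\beta_f)+(1-\beta_m)}\ge\frac{C_3}{C_1},\qquad \frac{\beta_f}{1-\beta_f}\ge\frac{2\nu\zeta\gamma^2C_3}{(1-\nu)(\gamma^2-1)}+2\gamma^2,$$ where $C_1=\frac{\kappa_{fcd}}4\max\{\frac{\kappa_h}{\kappa_h+\kappa_{eg}},\frac{8\kappa_{ef}}{8\kappa_{ef}+\kappa_{fcd}\kappa_{eg}}\}$, $C_2=\frac12\eta_1\eta_2\kappa_{fcd}\min\{\frac{\eta_2}{\kappa_h},1\}-2\varepsilon_f$ and $C_3=1+\frac{3L_g}{2\zeta}Q_{\max}^2$. 6. The matrices are $(1-\beta_Q)$-probabilistically $\alpha_Q$-well aligned for some $\alpha_Q\in(0,1)$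 and $0\le\beta_Q<1-\frac1{2\beta_f\beta_m}$: for all $k$ and every $\mathcal F_{k-1}$-measurable random vector $v$ in $\mathbb{R}^n$, almost surely $\mathbb P\big(\|Q_k^\top v\|\ge\alpha_Q\|v\|\ \big|\ \mathcal F_{k-1}\big)\ge1-\beta_Q$. **Conclusion.** Almost surely, $\displaystyle\liminf_{k\to\infty}\|\nabla f(x_k)\|=0$. -/

import Mathlib

open MeasureTheory Filter
open scoped ProbabilityTheory NNReal

noncomputable section

namespace STARS

/-- Euclidean space of dimension `d`. -/
abbrev E (d : ℕ) := EuclideanSpace ℝ (Fin d)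

/-- The linear map between Euclidean spaces given by the matrix `A`. -/
abbrev app {m n : ℕ} (A : Matrix (Fin m) (Fin n) ℝ) (v : E n) : E m :=
  Matrix.toEuclideanLin A v

/-- Real matrices carry the product (Borel) sigma-algebra of their entries. -/
instance instMeasurableSpaceMatrix (m n : ℕ) : MeasurableSpace (Matrix (Fin m) (Fin n) ℝ) :=
  inferInstanceAs (MeasurableSpace (Fin m → Fin n → ℝ))

/-- A matrix (semi)norm is consistent with the Euclidean norms if `‖A v‖ ≤ N A * ‖v‖`. The spectral
and the Frobenius norms are examples. (Consistency forces `N` to be a norm.) -/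
def IsConsistent {m n : ℕ} (N : Seminorm ℝ (Matrix (Fin m) (Fin n) ℝ)) : Prop :=
  ∀ (A : Matrix (Fin m) (Fin n) ℝ) (v : E n), ‖app A v‖ ≤ N A * ‖v‖

/-- Coefficients of a quadratic model on `ℝ^p`: constant term, model gradient, and symmetric
model Hessian. -/
structure QuadModel (p : ℕ) where
  c : ℝ
  g : E p
  H : Matrix (Fin p) (Fin p) ℝ
  symm : H.IsSymm

/-- The model function `s ↦ c + gᵀ s + sᵀ H s`. -/
def QuadModel.eval {p : ℕ} (M : QuadModel p) (s : E p) : ℝ :=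
  M.c + inner ℝ M.g s + inner ℝ s (app M.H s)

/-- The sigma-algebra on models generated by their coefficients. -/
instance instMeasurableSpaceQuadModel (p : ℕ) : MeasurableSpace (QuadModel p) :=
  MeasurableSpace.comap (fun M : QuadModel p => (M.c, M.g, M.H)) inferInstance

/-- The constants chosen in the initialization of the algorithm. -/
structure Params (n : ℕ) where
  /-- the trust-region update factor -/
  γ : ℝ
  /-- the threshold for the ratio of the estimated to the predicted decrease -/
  η₁ : ℝ
  /-- the threshold for the model gradient relative to the radius -/
  η₂ : ℝ
  /-- the exponent that determines the maximum radius -/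
  jmax : ℕ
  /-- the initial trust-region radius -/
  δ₀ : ℝ
  /-- the starting point -/
  x₀ : E n
  one_lt_γ : 1 < γ
  η₁_pos : 0 < η₁
  η₁_lt_one : η₁ < 1
  η₂_pos : 0 < η₂
  δ₀_pos : 0 < δ₀

/-- The maximum trust-region radius `δ_max = γ ^ j_max * δ₀`. -/
def Params.δmax {n : ℕ} (P : Params n) : ℝ := P.γ ^ P.jmax * P.δ₀

/-- The random inputs of the iterations: at iteration `k` the subspace matrix `Q k`, the model
`model k`, the trial step `step k`, and the estimates `f0 k` and `fs k` of the objective at the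
current iterate and at the trial point. -/
structure Inputs (n p : ℕ) (Ω : Type*) where
  Q : ℕ → Ω → Matrix (Fin n) (Fin p) ℝ
  model : ℕ → Ω → QuadModel p
  step : ℕ → Ω → E p
  f0 : ℕ → Ω → ℝ
  fs : ℕ → Ω → ℝ

section Run

variable {n p : ℕ} {Ω : Type*}

/-- The ratio of the estimated decrease to the decrease predicted by the model. -/
def Inputs.ρ (D : Inputs n p Ω) (k : ℕ) (ω : Ω) : ℝ :=
  (D.f0 k ω - D.fs k ω) / ((D.model k ω).eval 0 - (D.model k ω).eval (D.step k ω))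

open Classical in
/-- The pair (iterate, trust-region radius) at iteration `k`. An iteration is successful if
`ρ ≥ η₁` and `‖g‖ ≥ η₂ * δ`. -/
def state (P : Params n) (D : Inputs n p Ω) : ℕ → Ω → E n × ℝ
  | 0, _ => (P.x₀, P.δ₀)
  | k + 1, ω =>
    if P.η₁ ≤ D.ρ k ω ∧ P.η₂ * (state P D k ω).2 ≤ ‖(D.model k ω).g‖ then
      ((state P D k ω).1 + app (D.Q k ω) (D.step k ω), min (P.γ * (state P D k ω).2) P.δmax)
    else
      ((state P D k ω).1, P.γ⁻¹ * (state P D k ω).2)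

/-- The random iterate `x_k`. -/
def iter (P : Params n) (D : Inputs n p Ω) (k : ℕ) (ω : Ω) : E n := (state P D k ω).1

/-- The random trust-region radius `δ_k`. -/
def radius (P : Params n) (D : Inputs n p Ω) (k : ℕ) (ω : Ω) : ℝ := (state P D k ω).2

/-- The sigma-algebra `F_{k-1}` generated by the matrices, models and estimates of all iterations
before iteration `k`. It is trivial for `k = 0`, since the starting point is deterministic. -/
@[reducible] def Inputs.past (D : Inputs n p Ω) (k : ℕ) : MeasurableSpace Ω :=
  ⨆ l : Fin k, MeasurableSpace.comap (D.f0 l) inferInstance ⊔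
    MeasurableSpace.comap (D.fs l) inferInstance ⊔
    MeasurableSpace.comap (D.model l) inferInstance ⊔
    MeasurableSpace.comap (D.Q l) inferInstance

/-- The sigma-algebra `F^Q_{k-1}`: the past and the current matrix `Q k`. -/
@[reducible] def Inputs.pastQ (D : Inputs n p Ω) (k : ℕ) : MeasurableSpace Ω :=
  D.past k ⊔ MeasurableSpace.comap (D.Q k) inferInstance

/-- The sigma-algebra `F^{m Q}_{k-1}`: the past, the current matrix `Q k` and the current model. -/
@[reducible] def Inputs.pastMQ (D : Inputs n p Ω) (k : ℕ) : MeasurableSpace Ω :=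
  D.pastQ k ⊔ MeasurableSpace.comap (D.model k) inferInstance

/-- `D` is a run of the algorithm: its matrices, models and estimates are random variables, and each
trial step is computed from what is known when the model has been built, lies in the trust region
and satisfies the fraction `κfcd` of the Cauchy decrease. -/
structure IsRun [MeasurableSpace Ω] (P : Params n) (N : Seminorm ℝ (Matrix (Fin p) (Fin p) ℝ))
    (κfcd : ℝ) (D : Inputs n p Ω) : Prop where
  measurable_Q : ∀ k, Measurable (D.Q k)
  measurable_model : ∀ k, Measurable (D.model k)
  measurable_f0 : ∀ k, Measurable (D.f0 k)
  measurable_fs : ∀ k, Measurable (D.fs k)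
  measurable_step : ∀ k, Measurable[D.pastMQ k] (D.step k)
  step_le : ∀ k ω, ‖D.step k ω‖ ≤ radius P D k ω
  cauchy_decrease : ∀ k ω,
    κfcd / 2 * ‖(D.model k ω).g‖ *
        min (radius P D k ω) (‖(D.model k ω).g‖ / max (N (D.model k ω).H) 1) ≤
      (D.model k ω).eval 0 - (D.model k ω).eval (D.step k ω)

/-- The region considered by the realizations of the algorithm: the union, over all realizations and
all `k`, of `{x_k + Q_k s : ‖s‖ ≤ δ_max}`. -/
def region (P : Params n) (D : Inputs n p Ω) : Set (E n) :=
  {y | ∃ (ω : Ω) (k : ℕ) (s : E p), ‖s‖ ≤ P.δmax ∧ y = iter P D k ω + app (D.Q k ω) s}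

/-- The model `m` is `(κef, κeg; Q)`-fully linear for `f` on `{x + Q s : ‖s‖ ≤ δ}`. -/
def IsFullyLinear (f : E n → ℝ) (κef κeg : ℝ) (Q : Matrix (Fin n) (Fin p) ℝ) (x : E n) (δ : ℝ)
    (m : E p → ℝ) : Prop :=
  ∀ s : E p, ‖s‖ ≤ δ → |f (x + app Q s) - m s| ≤ κef * δ ^ 2 ∧
    ‖app Q.transpose (gradient f (x + app Q s)) - gradient m s‖ ≤ κeg * δ

/-- `a` and `b` are `εf`-accurate estimates of `f x` and `f y` for the radius `δ`. -/
def AreAccurate (f : E n → ℝ) (εf : ℝ) (x y : E n) (δ a b : ℝ) : Prop :=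
  |a - f x| ≤ εf * δ ^ 2 ∧ |b - f y| ≤ εf * δ ^ 2

/-- The event `I_k` that the model of iteration `k` is fully linear. -/
def goodModel (f : E n → ℝ) (κef κeg : ℝ) (P : Params n) (D : Inputs n p Ω) (k : ℕ) : Set Ω :=
  {ω | IsFullyLinear f κef κeg (D.Q k ω) (iter P D k ω) (radius P D k ω) (D.model k ω).eval}

/-- The event `J_k` that the estimates of iteration `k` are accurate. -/
def goodEstimates (f : E n → ℝ) (εf : ℝ) (P : Params n) (D : Inputs n p Ω) (k : ℕ) : Set Ω :=
  {ω | AreAccurate f εf (iter P D k ω) (iter P D k ω + app (D.Q k ω) (D.step k ω))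
    (radius P D k ω) (D.f0 k ω) (D.fs k ω)}

/-- The models are `βm`-probabilistically `(κef, κeg; Q_k)`-fully linear. -/
def ProbFullyLinear [MeasurableSpace Ω] (μ : Measure Ω) (f : E n → ℝ) (κef κeg βm : ℝ)
    (P : Params n) (D : Inputs n p Ω) : Prop :=
  ∀ k, ∀ᵐ ω ∂μ, βm ≤ (μ⟦goodModel f κef κeg P D k | D.pastQ k⟧) ω

/-- The estimates are `βf`-probabilistically `εf`-accurate. -/
def ProbAccurate [MeasurableSpace Ω] (μ : Measure Ω) (f : E n → ℝ) (εf βf : ℝ)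
    (P : Params n) (D : Inputs n p Ω) : Prop :=
  ∀ k, ∀ᵐ ω ∂μ, βf ≤ (μ⟦goodEstimates f εf P D k | D.pastMQ k⟧) ω

/-- The matrices are `(1 - βQ)`-probabilistically `αQ`-well aligned. -/
def ProbWellAligned [MeasurableSpace Ω] (μ : Measure Ω) (αQ βQ : ℝ) (D : Inputs n p Ω) : Prop :=
  ∀ (k : ℕ) (v : Ω → E n), Measurable[D.past k] v →
    ∀ᵐ ω ∂μ, 1 - βQ ≤
      (μ⟦{ω' | αQ * ‖v ω'‖ ≤ ‖app (D.Q k ω').transpose (v ω')‖} | D.past k⟧) ω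

end Run

/-- The constant `C₁`. -/
def C₁ (κfcd κh κef κeg : ℝ) : ℝ :=
  κfcd / 4 * max (κh / (κh + κeg)) (8 * κef / (8 * κef + κfcd * κeg))

/-- The constant `C₂`. -/
def C₂ (η₁ η₂ κfcd κh εf : ℝ) : ℝ :=
  1 / 2 * η₁ * η₂ * κfcd * min (η₂ / κh) 1 - 2 * εf

/-- The constant `C₃(ζ)`. -/
def C₃ (Lg Qmax ζ : ℝ) : ℝ := 1 + 3 * Lg / (2 * ζ) * Qmax ^ 2

end STARS

end

/-! The merit function `ν * f(x_k) + (1 - ν) * δ_k ^ 2` is a stochastic Lyapunov function. A failed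
iteration lowers it by shrinking the radius; a successful one trades a change of `f` against growth
of the radius. Let `G` be the norm of the projected gradient `Q_kᵀ ∇f(x_k)`, raised to at least `ζ *
δ_k`. If the projected gradient is large relative to the radius and both model and estimates are
accurate, the step is accepted and `f` falls by at least `C₁ * G * δ_k`. Accurate estimates alone,
or an accurate model with a large projected gradient, still guarantee the decrease of a failed
iteration. In every other case `f` rises by at most `C₃ * G * δ_k`. The probability bounds make the
good cases win on average (`expected_drift_large`, `expected_drift_small`), and conditioning in two
stages (`integral_le_of_condProb_ge`) yields an expected decrease of at least a fixed multiple of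
`𝔼[δ_k ^ 2]` (`integral_merit_succ_le`). As `f` is bounded below, these expectations are summable
and `δ_k → 0` almost surely (`ae_tendsto_radius`).

Suppose now that the gradients stay above some `c > 0`. Once `δ_k` is small, every iteration with
well-aligned matrix, accurate model and accurate estimates succeeds and multiplies the radius by `γ`
(`eventually_radius_growth`). Given the past, such iterations have probability at least `1 / 2`
(`condProb_good`), so the `±1` walk that counts them is a submartingale and almost surely unbounded
above (`ae_not_bddAbove_walk`). But from some index on `log_γ δ_k` rises at least as fast as this
walk, and it is bounded by `log_γ δ_max` (`bddAbove_walk_of_radius`): a contradiction. -/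

namespace STARS

/-! ### One iteration as inequalities between real numbers. -/

section Scalar

variable {κfcd κh κef κeg εf η₁ η₂ ζ δ g G h m0 ms fx fy a b : ℝ}

/-- Cauchy decrease for a model gradient that is large relative to the radius. -/
lemma decrease_of_large_gradient (hδ : 0 < δ) (hh : 1 ≤ h) (hh' : h ≤ κh)
    (hC : κfcd / 2 * g * min δ (g / h) ≤ m0 - ms) (hg : κh * δ ≤ g) :
    κfcd / 2 * g * δ ≤ m0 - ms := by
  have : δ ≤ g / h := by
    rw [le_div_iff₀ (by linarith)]
    nlinarith
  rwa [min_eq_left this] at hC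

/-- Accurate models and estimates make the ratio of decreases acceptable. -/
lemma ratio_ge_of_accurate (hκ : 0 < κfcd) (hδ : 0 < δ) (hh : 1 ≤ h) (hh' : h ≤ κh)
    (hC : κfcd / 2 * g * min δ (g / h) ≤ m0 - ms) (hg : κh * δ ≤ g)
    (hη₁ : η₁ < 1) (hg' : 8 * κef / (κfcd * (1 - η₁)) * δ ≤ g) (hε : εf ≤ κef)
    (h0 : |fx - m0| ≤ κef * δ ^ 2) (hs : |fy - ms| ≤ κef * δ ^ 2)
    (ha : |a - fx| ≤ εf * δ ^ 2) (hb : |b - fy| ≤ εf * δ ^ 2) :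
    η₁ ≤ (a - b) / (m0 - ms) := by
  have h1 := decrease_of_large_gradient hδ hh hh' hC hg
  have hκh : 0 < κh := by linarith
  have hgpos : 0 < g := lt_of_lt_of_le (by positivity) hg
  have hp : 0 < m0 - ms := lt_of_lt_of_le (by positivity) h1
  rw [le_div_iff₀ hp]
  have hη : 0 < 1 - η₁ := by linarith
  have h2 : 8 * κef * δ ≤ κfcd * (1 - η₁) * g := by
    rw [div_mul_eq_mul_div, div_le_iff₀ (by positivity)] at hg'
    linarith
  have h3 : εf * δ ^ 2 ≤ κef * δ ^ 2 := by gcongr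
  -- Two model errors and two estimate errors, each at most `κef * δ ^ 2`, together cost no more
  -- than the fraction `1 - η₁` of the predicted decrease.
  have h4 : 4 * κef * δ ^ 2 ≤ (1 - η₁) * (m0 - ms) := by nlinarith
  rw [abs_le] at *
  linarith [h0.1, h0.2, hs.1, hs.2, ha.1, ha.2, hb.1, hb.2]

/-- Decrease of the objective for an accurate model, in terms of the projected true gradient. -/
lemma objective_decrease_of_model (hκ : 0 < κfcd) (hδ : 0 < δ) (hh : 1 ≤ h) (hh' : h ≤ κh)
    (hκef : 0 < κef) (hκeg : 0 < κeg)
    (hC : κfcd / 2 * g * min δ (g / h) ≤ m0 - ms)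
    (hζ₁ : κeg + κh ≤ ζ) (hζ₂ : κeg + 8 * κef / κfcd ≤ ζ) (hG : ζ * δ ≤ G)
    (hgG : G ≤ g + κeg * δ)
    (h0 : |fx - m0| ≤ κef * δ ^ 2) (hs : |fy - ms| ≤ κef * δ ^ 2) :
    fy - fx ≤ -(C₁ κfcd κh κef κeg * G * δ) := by
  have hκh : 0 < κh := by linarith
  have e1 : (κeg + κh) * δ ≤ G := le_trans (by gcongr) hG
  have e2 : (κeg + 8 * κef / κfcd) * δ ≤ G := le_trans (by gcongr) hG
  have e3 : κh * δ ≤ g := by nlinarith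
  have e4 : 8 * κef * δ ≤ κfcd * g := by
    have : 8 * κef / κfcd * δ ≤ g := by nlinarith
    rw [div_mul_eq_mul_div, div_le_iff₀ hκ] at this
    linarith
  have h1 := decrease_of_large_gradient hδ hh hh' hC e3
  -- Each ratio comes from `G ≤ g + κeg * δ`: the first by bounding `δ` through `κh * δ ≤ g`, the
  -- second by bounding it through `G`.
  have h2 : max (κh / (κh + κeg)) (8 * κef / (8 * κef + κfcd * κeg)) * G ≤ g := by
    have e5 : (8 * κef + κfcd * κeg) * δ ≤ κfcd * G := by
      have : κfcd * ((κeg + 8 * κef / κfcd) * δ) ≤ κfcd * G := by gcongr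
      have e : κfcd * ((κeg + 8 * κef / κfcd) * δ) = (8 * κef + κfcd * κeg) * δ := by
        field_simp
        ring
      linarith
    rcases max_choice (κh / (κh + κeg)) (8 * κef / (8 * κef + κfcd * κeg)) with h | h <;>
      rw [h, div_mul_eq_mul_div, div_le_iff₀ (by positivity)]
    · nlinarith
    · have : κeg * ((8 * κef + κfcd * κeg) * δ) ≤ κeg * (κfcd * G) := by gcongr
      have t : (8 * κef + κfcd * κeg) * G ≤ (8 * κef + κfcd * κeg) * (g + κeg * δ) := by gcongr
      linarith
  have h3 : C₁ κfcd κh κef κeg * G ≤ κfcd / 4 * g := by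
    unfold C₁
    rw [mul_assoc]
    gcongr
  have h4 : C₁ κfcd κh κef κeg * G * δ ≤ κfcd / 4 * g * δ := by gcongr
  -- The model errors at the two points use up half of the Cauchy decrease, so `κfcd / 2` becomes
  -- `κfcd / 4`.
  have h5 : 2 * (κef * δ ^ 2) ≤ κfcd / 4 * g * δ := by nlinarith
  rw [abs_le] at *
  linarith [h0.1, h0.2, hs.1, hs.2]

/-- Decrease of the objective in a successful iteration with accurate estimates. -/
lemma objective_decrease_of_estimates (hκ : 0 < κfcd) (hδ : 0 < δ) (hh : 1 ≤ h) (hh' : h ≤ κh)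
    (hC : κfcd / 2 * g * min δ (g / h) ≤ m0 - ms)
    (hη₁ : 0 < η₁) (hη₂ : 0 < η₂) (hρ : η₁ ≤ (a - b) / (m0 - ms)) (hg : η₂ * δ ≤ g)
    (ha : |a - fx| ≤ εf * δ ^ 2) (hb : |b - fy| ≤ εf * δ ^ 2) :
    fy - fx ≤ -(C₂ η₁ η₂ κfcd κh εf * δ ^ 2) := by
  have hκh : 0 < κh := by linarith
  have hgpos : 0 < g := lt_of_lt_of_le (by positivity) hg
  have hp : 0 < m0 - ms := lt_of_lt_of_le (by positivity) hC
  rw [le_div_iff₀ hp] at hρ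
  have h1 : η₂ * δ * (min (η₂ / κh) 1 * δ) ≤ g * min δ (g / h) := by
    have : min (η₂ / κh) 1 * δ ≤ min δ (g / h) := by
      apply le_min
      · calc _ ≤ 1 * δ := by gcongr; exact min_le_right _ _
          _ = δ := one_mul _
      · calc _ ≤ η₂ / κh * δ := by gcongr; exact min_le_left _ _
          _ = η₂ * δ / κh := by ring
          _ ≤ g / h := by gcongr
    gcongr
  have h2 : η₁ * (κfcd / 2 * (η₂ * δ * (min (η₂ / κh) 1 * δ))) ≤ η₁ * (m0 - ms) := by
    gcongr
    refine le_trans ?_ hC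
    rw [mul_assoc _ g]
    exact mul_le_mul_of_nonneg_left h1 (by positivity)
  unfold C₂
  rw [abs_le] at *
  nlinarith [ha.1, ha.2, hb.1, hb.2]

lemma C₁_pos (hκ : 0 < κfcd) (hκh : 0 < κh) (hκeg : 0 < κeg) : 0 < C₁ κfcd κh κef κeg :=
  mul_pos (by positivity) (lt_max_of_lt_left (by positivity))

lemma C₂_pos (h : εf < 1 / 4 * η₁ * η₂ * κfcd * min (η₂ / κh) 1) :
    0 < C₂ η₁ η₂ κfcd κh εf := by
  unfold C₂
  linarith

lemma C₃_pos {Lg Qmax : ℝ} (hL : 0 ≤ Lg) (hζ : 0 < ζ) : 0 < C₃ Lg Qmax ζ := by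
  unfold C₃
  positivity

end Scalar

/-! ### Expected change of the merit function, as real inequalities. -/

section Drift

variable {ν γ ζ c₁ c₂ c₃ βf βm G δ : ℝ}

/-- Bound for the change of the merit function when the iteration fails. -/
noncomputable def driftFail (ν γ δ : ℝ) : ℝ := -((1 - ν) * (1 - (γ ^ 2)⁻¹) * δ ^ 2)

/-- Bound for the change of the merit function when the iteration succeeds and the objective
changes by at most `c * G * δ`. -/
noncomputable def driftSuccess (ν γ c G δ : ℝ) : ℝ := ν * (c * G * δ) + (1 - ν) * (γ ^ 2 - 1) * δ ^ 2

lemma mul_le_of_div_le_ratio {c : ℝ} (hν : ν < 1) (hc : 0 < c) (h : 8 * γ ^ 2 / c ≤ ν / (1 - ν)) :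
    8 * γ ^ 2 * (1 - ν) ≤ ν * c := by
  rwa [div_le_div_iff₀ hc (by linarith)] at h

lemma driftFail_le_driftSuccess (hν : 0 < ν) (hν' : ν < 1) (hγ : 1 < γ) (hc : 0 ≤ c₃)
    (hδ : 0 ≤ δ) (hG : 0 ≤ G) : driftFail ν γ δ ≤ driftSuccess ν γ c₃ G δ := by
  have h1 : (γ ^ 2)⁻¹ ≤ 1 := inv_le_one_of_one_le₀ (by nlinarith)
  have h2 : 0 ≤ (1 - ν) * (1 - (γ ^ 2)⁻¹) * δ ^ 2 :=
    mul_nonneg (mul_nonneg (by linarith) (by linarith)) (sq_nonneg δ)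
  have h3 : 0 ≤ (1 - ν) * (γ ^ 2 - 1) * δ ^ 2 :=
    mul_nonneg (mul_nonneg (by linarith) (by nlinarith)) (sq_nonneg δ)
  have h4 : 0 ≤ ν * (c₃ * G * δ) := by positivity
  unfold driftFail driftSuccess
  linarith

/-- A sufficient decrease of the objective outweighs the growth of the radius. -/
lemma success_le_driftFail (hν' : ν < 1) (hγ : 1 < γ) (hc : 8 * γ ^ 2 * (1 - ν) ≤ ν * c₂) {Δ : ℝ}
    (hΔ : Δ ≤ -(c₂ * δ ^ 2)) (hν : 0 < ν) :
    ν * Δ + (1 - ν) * (γ ^ 2 - 1) * δ ^ 2 ≤ driftFail ν γ δ := by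
  have h1 : 0 < (γ ^ 2)⁻¹ := by positivity
  have h2 : ν * Δ ≤ ν * (-(c₂ * δ ^ 2)) := by gcongr
  -- Only `(1 - ν) * (γ ^ 2 - (γ ^ 2)⁻¹) ≤ ν * c₂` is needed; the factor 8 is slack here.
  have h3 : 8 * γ ^ 2 * (1 - ν) * δ ^ 2 ≤ ν * c₂ * δ ^ 2 := by gcongr
  have h4 : 0 ≤ (1 - ν) * ((γ ^ 2)⁻¹) * δ ^ 2 :=
    mul_nonneg (mul_nonneg (by linarith) h1.le) (sq_nonneg δ)
  have h5 : 0 ≤ (1 - ν) * γ ^ 2 * δ ^ 2 :=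
    mul_nonneg (mul_nonneg (by linarith) (by positivity)) (sq_nonneg δ)
  unfold driftFail
  linarith

/-- The coefficient of the squared radius in the expected decrease of the merit function. -/
noncomputable def driftRate (ν γ βf : ℝ) : ℝ := (1 - ν) * min (γ ^ 2) (1 / 2 * βf * (1 - (γ ^ 2)⁻¹))

lemma driftRate_pos (hν' : ν < 1) (hγ : 1 < γ) (hβf : 0 < βf) : 0 < driftRate ν γ βf := by
  have h1 : (γ ^ 2)⁻¹ < 1 := inv_lt_one_of_one_lt₀ (by nlinarith)
  refine mul_pos (by linarith) (lt_min (by positivity) (mul_pos (by positivity) (by linarith)))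

/-- Expected change when the projected gradient is large relative to the radius. -/
lemma expected_drift_large (hν : 0 < ν) (hν' : ν < 1) (hγ : 1 < γ) (hζ : 0 < ζ)
    (hc₁ : 0 < c₁) (hc₃ : 0 < c₃)
    (hβf : 0 < βf) (hβf' : βf < 1) (hβm : 0 < βm) (hβm' : βm < 1)
    (hν₁ : 8 * γ ^ 2 * (1 - ν) ≤ ν * (ζ * c₁))
    (hβ : c₃ / c₁ ≤ (βf * βm - 1 / 2) / ((1 - βf) + (1 - βm))) (hδ : 0 ≤ δ) (hG : ζ * δ ≤ G) :
    βm * (βf * driftSuccess ν γ (-c₁) G δ + (1 - βf) * driftFail ν γ δ) +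
      (1 - βm) * (βf * driftFail ν γ δ + (1 - βf) * driftSuccess ν γ c₃ G δ) ≤
      -(driftRate ν γ βf * δ ^ 2) := by
  have hG0 : 0 ≤ G := le_trans (by positivity) hG
  rw [div_le_div_iff₀ hc₁ (by linarith)] at hβ
  -- The failure branches are charged the worst-case radius growth. The weights of all branches sum
  -- to 1, so this growth is counted once in total.
  have hb : driftFail ν γ δ ≤ (1 - ν) * (γ ^ 2 - 1) * δ ^ 2 := by
    have := driftFail_le_driftSuccess (c₃ := 0) hν hν' hγ le_rfl hδ hG0
    simpa [driftSuccess] using this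
  -- The ratio condition on `βf` and `βm` leaves half of `c₁` after paying for the case where both
  -- model and estimates are bad.
  have h1 : c₁ / 2 ≤ βf * βm * c₁ - (1 - βf) * (1 - βm) * c₃ := by
    have : (1 - βf) * (1 - βm) * c₃ ≤ ((1 - βf) + (1 - βm)) * c₃ := by
      gcongr
      nlinarith
    linarith
  have h2 : ζ * δ * δ ≤ G * δ := by gcongr
  have h3 : ν * (c₁ / 2 * (G * δ)) ≤
      ν * ((βf * βm * c₁ - (1 - βf) * (1 - βm) * c₃) * (G * δ)) := by gcongr
  have h4 : ν * c₁ * (ζ * δ * δ) ≤ ν * c₁ * (G * δ) := by gcongr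
  have h5 : 8 * γ ^ 2 * (1 - ν) * δ ^ 2 ≤ ν * (ζ * c₁) * δ ^ 2 := by gcongr
  have h6 : driftRate ν γ βf * δ ^ 2 ≤ (1 - ν) * γ ^ 2 * δ ^ 2 := by
    unfold driftRate
    gcongr
    exact min_le_left _ _
  have h7 : (βm * (1 - βf) + (1 - βm) * βf) * driftFail ν γ δ ≤
      (βm * (1 - βf) + (1 - βm) * βf) * ((1 - ν) * (γ ^ 2 - 1) * δ ^ 2) := by
    refine mul_le_mul_of_nonneg_left hb (add_nonneg (mul_nonneg ?_ ?_) (mul_nonneg ?_ ?_)) <;>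
      linarith
  have h8 : 0 ≤ (1 - ν) * δ ^ 2 := mul_nonneg (by linarith) (sq_nonneg δ)
  have h9 : 0 ≤ (1 - ν) * γ ^ 2 * δ ^ 2 :=
    mul_nonneg (mul_nonneg (by linarith) (by positivity)) (sq_nonneg δ)
  unfold driftSuccess
  linarith

/-- Expected change when the projected gradient is small relative to the radius. -/
lemma expected_drift_small (hν : 0 < ν) (hν' : ν < 1) (hγ : 1 < γ)
    (hβf' : βf < 1)
    (hβ : 2 * ν * ζ * γ ^ 2 * c₃ / ((1 - ν) * (γ ^ 2 - 1)) + 2 * γ ^ 2 ≤ βf / (1 - βf)) :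
    βf * driftFail ν γ δ + (1 - βf) * driftSuccess ν γ c₃ (ζ * δ) δ ≤
      -(driftRate ν γ βf * δ ^ 2) := by
  have hγ2 : 0 < γ ^ 2 - 1 := by nlinarith
  have hν1 : 0 < 1 - ν := by linarith
  have hγ0 : 0 < γ ^ 2 := by positivity
  rw [le_div_iff₀ (by linarith)] at hβ
  -- Multiplying by `(1 - ν) * (1 - (γ ^ 2)⁻¹)` clears the denominators. Half of the expected gain
  -- from failure then pays for inaccurate estimates; the other half is `driftRate`.
  have h1 : 2 * (1 - βf) * (ν * (ζ * c₃) + (1 - ν) * (γ ^ 2 - 1)) ≤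
      βf * ((1 - ν) * (1 - (γ ^ 2)⁻¹)) := by
    have : (2 * ν * ζ * γ ^ 2 * c₃ / ((1 - ν) * (γ ^ 2 - 1)) + 2 * γ ^ 2) * (1 - βf) *
        ((1 - ν) * (1 - (γ ^ 2)⁻¹)) ≤ βf * ((1 - ν) * (1 - (γ ^ 2)⁻¹)) := by
      refine mul_le_mul_of_nonneg_right hβ (mul_nonneg hν1.le ?_)
      have : (γ ^ 2)⁻¹ ≤ 1 := inv_le_one_of_one_le₀ (by linarith)
      linarith
    refine le_trans (le_of_eq ?_) this
    field_simp
  have h2 : driftRate ν γ βf * δ ^ 2 ≤ (1 - ν) * (1 / 2 * βf * (1 - (γ ^ 2)⁻¹)) * δ ^ 2 := by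
    unfold driftRate
    gcongr
    exact min_le_right _ _
  have h3 := mul_le_mul_of_nonneg_right h1 (sq_nonneg δ)
  unfold driftSuccess driftFail
  linarith

end Drift

/-! ### Transposes and first-order expansion. -/

section Geometry

variable {n p : ℕ}

lemma inner_app_left (A : Matrix (Fin n) (Fin p) ℝ) (s : E p) (v : E n) :
    inner ℝ v (app A s) = inner ℝ (app A.transpose v) s := by
  have h := Matrix.toEuclideanLin_conjTranspose_eq_adjoint A
  rw [Matrix.conjTranspose_eq_transpose_of_trivial] at h
  rw [app, app, h, LinearMap.adjoint_inner_left]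

/-- Consistency of the matrix norm says nothing about the transpose, so the bound is passed to the
adjoint through `‖Aᵀ v‖ ^ 2 = ⟪v, A Aᵀ v⟫`. -/
lemma norm_app_transpose_le {A : Matrix (Fin n) (Fin p) ℝ} {c : ℝ} (hc : 0 ≤ c)
    (h : ∀ s : E p, ‖app A s‖ ≤ c * ‖s‖) (v : E n) : ‖app A.transpose v‖ ≤ c * ‖v‖ := by
  rcases eq_or_lt_of_le (norm_nonneg (app A.transpose v)) with h0 | h0
  · rw [← h0]
    positivity
  · have h1 : ‖app A.transpose v‖ ^ 2 ≤ ‖v‖ * (c * ‖app A.transpose v‖) := by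
      rw [← real_inner_self_eq_norm_sq, ← inner_app_left]
      exact (real_inner_le_norm _ _).trans (by gcongr; exact h _)
    nlinarith

/-- First-order upper bound of the objective along the image of a ball. -/
lemma sub_le_of_lipschitz_gradient {f : E n → ℝ} (hf : Differentiable ℝ f) {L : ℝ≥0} {U : Set (E n)}
    (hL : LipschitzOnWith L (gradient f) U) {x d : E n}
    (hU : ∀ t ∈ Set.Icc (0 : ℝ) 1, x + t • d ∈ U) :
    f (x + d) - f x ≤ inner ℝ (gradient f x) d + L * ‖d‖ ^ 2 := by
  have hline (t : ℝ) : HasDerivAt (fun t : ℝ => f (x + t • d))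
      (inner ℝ (gradient f (x + t • d)) d) t := by
    have h1 : HasDerivAt (fun t : ℝ => x + t • d) d t := by
      simpa using ((hasDerivAt_id t).smul_const d).const_add x
    have h2 := (hf (x + t • d)).hasGradientAt.hasFDerivAt.comp_hasDerivAt t h1
    simpa [Function.comp_def] using h2
  -- The mean value theorem gives the constant `L` instead of the sharp `L / 2`; the factor `3 / 2`
  -- in `C₃` leaves room for this.
  obtain ⟨t, ht, hd⟩ := exists_hasDerivAt_eq_slope (fun t : ℝ => f (x + t • d)) _ zero_lt_one
    (fun t _ => (hline t).continuousAt.continuousWithinAt) (fun t _ => hline t)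
  have ht' : t ∈ Set.Icc (0 : ℝ) 1 := ⟨ht.1.le, ht.2.le⟩
  simp only [one_smul, zero_smul, add_zero, sub_zero, div_one] at hd
  rw [← hd]
  have h3 : ‖gradient f (x + t • d) - gradient f x‖ ≤ L * ‖d‖ := by
    have h0 := hU 0 (by simp)
    rw [zero_smul, add_zero] at h0
    refine (hL.norm_sub_le (hU t ht') h0).trans ?_
    rw [add_sub_cancel_left, norm_smul, Real.norm_of_nonneg ht'.1]
    gcongr
    exact mul_le_of_le_one_left (norm_nonneg _) ht'.2
  have h4 : inner ℝ (gradient f (x + t • d) - gradient f x) d ≤ L * ‖d‖ ^ 2 :=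
    (real_inner_le_norm _ _).trans (by nlinarith [norm_nonneg d])
  rw [inner_sub_left] at h4
  linarith

end Geometry

/-! ### Conditional probabilities. -/

section CondProb

variable {Ω : Type*} {m m' mΩ : MeasurableSpace Ω} {μ : Measure Ω} [IsProbabilityMeasure μ]
  {S J : Set Ω} {c : ℝ}

lemma indicator_one_inter (S J : Set Ω) : (S ∩ J).indicator (fun _ => (1 : ℝ)) =
    S.indicator (fun _ => (1 : ℝ)) * J.indicator (fun _ => (1 : ℝ)) := by
  ext ω
  by_cases h : ω ∈ S <;> by_cases h' : ω ∈ J <;> simp [h, h']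

lemma integrable_indicator_one (hS : MeasurableSet S) :
    Integrable (S.indicator fun _ => (1 : ℝ)) μ :=
  (integrable_const 1).indicator hS

/-- Intersecting with an event of conditional probability at least `c` costs at most a factor
`c`. -/
lemma mul_condProb_le_condProb_inter (hm : m ≤ m') (hm' : m' ≤ mΩ) (hS : MeasurableSet[m'] S)
    (hJ : MeasurableSet J) (hc : ∀ᵐ ω ∂μ, c ≤ (μ⟦J|m'⟧) ω) :
    ∀ᵐ ω ∂μ, c * (μ⟦S|m⟧) ω ≤ (μ⟦S ∩ J|m⟧) ω := by
  -- `S` is known at `m'`, so its indicator leaves the conditional expectation; the tower property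
  -- then descends to `m`.
  have h1 : μ⟦S ∩ J|m'⟧ =ᵐ[μ] S.indicator (fun _ => (1 : ℝ)) * μ⟦J|m'⟧ := by
    rw [indicator_one_inter]
    refine condExp_mul_of_stronglyMeasurable_left (stronglyMeasurable_const.indicator hS) ?_
      (integrable_indicator_one hJ)
    rw [← indicator_one_inter]
    exact integrable_indicator_one ((hm' _ hS).inter hJ)
  have h2 : μ[μ⟦S ∩ J|m'⟧|m] =ᵐ[μ] μ⟦S ∩ J|m⟧ := condExp_condExp_of_le hm hm'
  have h3 : μ[c • S.indicator (fun _ => (1 : ℝ))|m] ≤ᵐ[μ] μ[μ⟦S ∩ J|m'⟧|m] := by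
    refine condExp_mono ((integrable_indicator_one (hm' _ hS)).smul c) integrable_condExp ?_
    filter_upwards [h1, hc] with ω h1 hc
    rw [h1]
    by_cases hω : ω ∈ S <;> simp [hω, hc]
  filter_upwards [h2, h3, condExp_smul c (S.indicator (fun _ => (1 : ℝ))) m (μ := μ)]
    with ω h2 h3 h4
  rw [← h2]
  rw [h4] at h3
  simpa using h3

/-- The weight is known at `m`, so `∫ 1_J w = ∫ w P(J | m)`. Inside an integral, the indicator of
`J` may thus be traded for the constant `c`. -/
lemma mul_integral_le_setIntegral (hm : m ≤ mΩ) {w : Ω → ℝ} (hw : StronglyMeasurable[m] w)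
    (hw0 : ∀ ω, 0 ≤ w ω) (hwi : Integrable w μ) (hJ : MeasurableSet J)
    (hc : ∀ᵐ ω ∂μ, c ≤ (μ⟦J|m⟧) ω) :
    c * ∫ ω, w ω ∂μ ≤ ∫ ω, J.indicator w ω ∂μ := by
  have hmul : w * J.indicator (fun _ => (1 : ℝ)) = J.indicator w := by
    ext ω
    by_cases hω : ω ∈ J <;> simp [hω]
  have h1 : μ[J.indicator w|m] =ᵐ[μ] w * μ⟦J|m⟧ := by
    rw [← hmul]
    refine condExp_mul_of_stronglyMeasurable_left hw ?_ (integrable_indicator_one hJ)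
    rw [hmul]
    exact hwi.indicator hJ
  rw [← integral_condExp hm (f := J.indicator w), ← integral_const_mul]
  refine integral_mono_ae (hwi.const_mul c) integrable_condExp ?_
  filter_upwards [h1, hc] with ω h1 hc
  rw [h1, Pi.mul_apply, mul_comm]
  exact mul_le_mul_of_nonneg_left hc (hw0 ω)

/-- A positive lower bound of the conditional probability of an arbitrary set is inherited by
measurable supersets. -/
lemma condProb_ge_of_subset (hc0 : 0 < c) (hSJ : S ⊆ J) (hJ : MeasurableSet J)
    (hc : ∀ᵐ ω ∂μ, c ≤ (μ⟦S|m⟧) ω) : ∀ᵐ ω ∂μ, c ≤ (μ⟦J|m⟧) ω := by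
  by_cases hi : Integrable (S.indicator fun _ => (1 : ℝ)) μ
  · have := condExp_mono (m := m) hi (integrable_indicator_one hJ)
      (Eventually.of_forall fun ω =>
        Set.indicator_le_indicator_of_subset hSJ (fun _ => zero_le_one) ω)
    filter_upwards [hc, this] with ω h1 h2 using h1.trans h2
  -- By convention the conditional expectation of a nonintegrable function is 0, which is
  -- incompatible with the lower bound `c > 0`.
  · rw [condExp_of_not_integrable hi] at hc
    obtain ⟨ω, hω⟩ := hc.exists
    exact absurd hω (by simpa using hc0)

end CondProb

/-! ### Measurability, and adaptedness of the iterates and radii. -/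

section Measurability

variable {Ω : Type*} {m : MeasurableSpace Ω} {n p : ℕ}

lemma measurable_app {A : Ω → Matrix (Fin n) (Fin p) ℝ} {v : Ω → E p} (hA : Measurable[m] A)
    (hv : Measurable[m] v) : Measurable[m] fun ω => app (A ω) (v ω) := by
  have hA' (i j) : Measurable[m] fun ω => A ω i j :=
    (measurable_pi_apply j).comp ((measurable_pi_apply i).comp hA)
  have hv' (j) : Measurable[m] fun ω => v ω j := by fun_prop
  have : Measurable[m] fun ω i => ∑ j, A ω i j * v ω j := by
    refine measurable_pi_lambda _ fun i => Finset.measurable_sum _ fun j _ => ?_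
    exact (hA' i j).mul (hv' j)
  exact (WithLp.measurable_toLp 2 (Fin n → ℝ)).comp this

lemma measurable_transpose {A : Ω → Matrix (Fin n) (Fin p) ℝ} (hA : Measurable[m] A) :
    Measurable[m] fun ω => (A ω).transpose :=
  measurable_pi_lambda _ fun j => measurable_pi_lambda _ fun i =>
    (measurable_pi_apply j).comp ((measurable_pi_apply i).comp hA)

lemma QuadModel.measurable_coeffs :
    Measurable fun M : QuadModel p => (M.c, M.g, M.H) := comap_measurable _

lemma QuadModel.measurable_g {M : Ω → QuadModel p} (hM : Measurable[m] M) :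
    Measurable[m] fun ω => (M ω).g :=
  (QuadModel.measurable_coeffs.comp hM).snd.fst

lemma QuadModel.measurable_eval {M : Ω → QuadModel p} {s : Ω → E p} (hM : Measurable[m] M)
    (hs : Measurable[m] s) : Measurable[m] fun ω => (M ω).eval (s ω) := by
  have h := QuadModel.measurable_coeffs.comp hM
  have hc : Measurable[m] fun ω => (M ω).c := h.fst
  have hH : Measurable[m] fun ω => (M ω).H := h.snd.snd
  exact (hc.add ((QuadModel.measurable_g hM).inner hs)).add (hs.inner (measurable_app hH hs))

lemma continuous_gradient {f : E n → ℝ} (hf : ContDiff ℝ 1 f) : Continuous (gradient f) :=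
  (InnerProductSpace.toDual ℝ (E n)).symm.continuous.comp (hf.continuous_fderiv one_ne_zero)

variable {D : Inputs n p Ω} {P : Params n}

lemma past_le_pastQ (D : Inputs n p Ω) (k : ℕ) : D.past k ≤ D.pastQ k := le_sup_left

lemma pastQ_le_pastMQ (D : Inputs n p Ω) (k : ℕ) : D.pastQ k ≤ D.pastMQ k := le_sup_left

lemma past_mono (D : Inputs n p Ω) : Monotone D.past := fun _ l h =>
  iSup_le fun i => le_iSup (fun j : Fin l => MeasurableSpace.comap (D.f0 j) inferInstance ⊔
    MeasurableSpace.comap (D.fs j) inferInstance ⊔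
    MeasurableSpace.comap (D.model j) inferInstance ⊔
    MeasurableSpace.comap (D.Q j) inferInstance) (Fin.castLE h i)

lemma comap_le_past_succ (D : Inputs n p Ω) (k : ℕ) :
    MeasurableSpace.comap (D.f0 k) inferInstance ⊔
      MeasurableSpace.comap (D.fs k) inferInstance ⊔
      MeasurableSpace.comap (D.model k) inferInstance ⊔
      MeasurableSpace.comap (D.Q k) inferInstance ≤ D.past (k + 1) :=
  le_iSup (fun j : Fin (k + 1) => MeasurableSpace.comap (D.f0 j) inferInstance ⊔
    MeasurableSpace.comap (D.fs j) inferInstance ⊔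
    MeasurableSpace.comap (D.model j) inferInstance ⊔
    MeasurableSpace.comap (D.Q j) inferInstance) (Fin.last k)

lemma measurable_f0_past (D : Inputs n p Ω) (k : ℕ) : Measurable[D.past (k + 1)] (D.f0 k) :=
  measurable_iff_comap_le.2
    ((le_sup_left.trans (le_sup_left.trans le_sup_left)).trans (comap_le_past_succ D k))

lemma measurable_fs_past (D : Inputs n p Ω) (k : ℕ) : Measurable[D.past (k + 1)] (D.fs k) :=
  measurable_iff_comap_le.2
    ((le_sup_right.trans (le_sup_left.trans le_sup_left)).trans (comap_le_past_succ D k))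

lemma measurable_Q_pastQ (D : Inputs n p Ω) (k : ℕ) : Measurable[D.pastQ k] (D.Q k) :=
  measurable_iff_comap_le.2 le_sup_right

lemma measurable_model_pastMQ (D : Inputs n p Ω) (k : ℕ) : Measurable[D.pastMQ k] (D.model k) :=
  measurable_iff_comap_le.2 le_sup_right

lemma pastMQ_le_past_succ (D : Inputs n p Ω) (k : ℕ) : D.pastMQ k ≤ D.past (k + 1) :=
  sup_le (sup_le (past_mono D k.le_succ) (le_sup_right.trans (comap_le_past_succ D k)))
    ((le_sup_right.trans le_sup_left).trans (comap_le_past_succ D k))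

lemma measurable_state_succ {k : ℕ} (hst : Measurable[m] (state P D k))
    (hQ : Measurable[m] (D.Q k)) (hM : Measurable[m] (D.model k)) (hs : Measurable[m] (D.step k))
    (h0 : Measurable[m] (D.f0 k)) (h1 : Measurable[m] (D.fs k)) :
    Measurable[m] (state P D (k + 1)) := by
  have hρ : Measurable[m] (D.ρ k) :=
    (h0.sub h1).div
      ((QuadModel.measurable_eval hM measurable_const).sub (QuadModel.measurable_eval hM hs))
  have hset : MeasurableSet[m]
      {ω | P.η₁ ≤ D.ρ k ω ∧ P.η₂ * (state P D k ω).2 ≤ ‖(D.model k ω).g‖} :=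
    (measurableSet_le measurable_const hρ).inter
      (measurableSet_le (hst.snd.const_mul _) (QuadModel.measurable_g hM).norm)
  exact Measurable.ite hset
    ((hst.fst.add (measurable_app hQ hs)).prodMk ((hst.snd.const_mul _).min measurable_const))
    (hst.fst.prodMk (hst.snd.const_mul _))

variable [mΩ : MeasurableSpace Ω]

lemma past_le {N : Seminorm ℝ (Matrix (Fin p) (Fin p) ℝ)} {κ : ℝ} (hD : IsRun P N κ D) (k : ℕ) :
    D.past k ≤ mΩ :=
  iSup_le fun i => sup_le (sup_le (sup_le (hD.measurable_f0 i).comap_le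
    (hD.measurable_fs i).comap_le) (hD.measurable_model i).comap_le) (hD.measurable_Q i).comap_le

/-- Trial steps are not among the generators of the past, but they are determined by the past, `Q k`
and `model k`, all of which belong to `past (k + 1)`. -/
lemma measurable_state {N : Seminorm ℝ (Matrix (Fin p) (Fin p) ℝ)} {κ : ℝ}
    (hD : IsRun P N κ D) (k : ℕ) : Measurable[D.past k] (state P D k) := by
  induction k with
  | zero => exact measurable_const
  | succ k ih =>
    have hmq := pastMQ_le_past_succ D k
    exact measurable_state_succ (ih.mono (past_mono D k.le_succ) le_rfl)
      ((measurable_Q_pastQ D k).mono ((pastQ_le_pastMQ D k).trans hmq) le_rfl)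
      ((measurable_model_pastMQ D k).mono hmq le_rfl) ((hD.measurable_step k).mono hmq le_rfl)
      (measurable_f0_past D k) (measurable_fs_past D k)

end Measurability

/-! ### Summable decrease, two-stage conditioning, and the random walk. -/

section Probability

variable {Ω : Type*} {m m' mΩ : MeasurableSpace Ω} {μ : Measure Ω}

/-- Nonnegative functions whose integrals are controlled by the decrease of a sequence that is
bounded below tend to zero almost everywhere. -/
lemma ae_tendsto_zero_of_integral_decrease {g : ℕ → Ω → ℝ} {Φ : ℕ → ℝ} {σ c : ℝ} (hσ : 0 < σ)
    (hg0 : ∀ k ω, 0 ≤ g k ω) (hgi : ∀ k, Integrable (g k) μ) (hc : ∀ k, c ≤ Φ k)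
    (hΦ : ∀ k, Φ (k + 1) + σ * ∫ ω, g k ω ∂μ ≤ Φ k) :
    ∀ᵐ ω ∂μ, Tendsto (fun k => g k ω) atTop (nhds 0) := by
  have hsum (K : ℕ) : σ * ∑ k ∈ Finset.range K, ∫ ω, g k ω ∂μ ≤ Φ 0 - Φ K := by
    induction K with
    | zero => simp
    | succ K ih =>
      rw [Finset.sum_range_succ, mul_add]
      linarith [hΦ K]
  have hI0 (k) : 0 ≤ ∫ ω, g k ω ∂μ := integral_nonneg (hg0 k)
  have hs : Summable fun k => ∫ ω, g k ω ∂μ := by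
    refine summable_of_sum_range_le (c := (Φ 0 - c) / σ) hI0 fun K => ?_
    rw [le_div_iff₀ hσ, mul_comm]
    linarith [hsum K, hc K]
  -- By Tonelli the sum of the functions has finite integral, hence is finite almost everywhere and
  -- its terms tend to zero.
  have hfin : ∫⁻ ω, ∑' k, ENNReal.ofReal (g k ω) ∂μ ≠ ⊤ := by
    rw [lintegral_tsum fun k => (hgi k).aestronglyMeasurable.aemeasurable.ennreal_ofReal]
    simp_rw [← ofReal_integral_eq_lintegral_ofReal (hgi _) (Eventually.of_forall (hg0 _))]
    exact hs.tsum_ofReal_ne_top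
  have hae := ae_lt_top' (AEMeasurable.tsum fun k =>
    (hgi k).aestronglyMeasurable.aemeasurable.ennreal_ofReal) hfin
  filter_upwards [hae] with ω hω
  have h := ENNReal.tendsto_atTop_zero_of_tsum_ne_top hω.ne
  have h' := (ENNReal.tendsto_toReal ENNReal.zero_ne_top).comp h
  simpa [Function.comp_def, ENNReal.toReal_ofReal (hg0 _ ω)] using h'

variable [IsProbabilityMeasure μ]

/-- Integral of a bound that depends on an event `I` of conditional probability at least `q` and
on an event `J` whose conditional probability, after observing `I`, is at least `r`. -/
lemma integral_le_of_condProb_ge (hm : m ≤ m') (hm' : m' ≤ mΩ) {T I J : Set Ω} {q r : ℝ}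
    {X a b d τ : Ω → ℝ} (hr0 : 0 ≤ r) (hr1 : r ≤ 1)
    (hT : MeasurableSet[m] T) (hI : MeasurableSet[m'] I) (hJ : MeasurableSet J)
    (ha : StronglyMeasurable[m] a) (hb : StronglyMeasurable[m] b) (hd : StronglyMeasurable[m] d)
    (hXi : Integrable X μ) (hai : Integrable a μ) (hbi : Integrable b μ) (hdi : Integrable d μ)
    (hτi : Integrable τ μ)
    (hab : ∀ ω, a ω ≤ b ω) (hbd : ∀ ω, b ω ≤ d ω)
    (hXd : ∀ ω, X ω ≤ d ω) (hXb : ∀ ω, ω ∈ T ∩ I ∨ ω ∈ J → X ω ≤ b ω)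
    (hXa : ∀ ω, ω ∈ T ∩ I → ω ∈ J → X ω ≤ a ω)
    (hq : ∀ᵐ ω ∂μ, q ≤ (μ⟦I|m⟧) ω) (hr : ∀ᵐ ω ∂μ, r ≤ (μ⟦J|m'⟧) ω)
    (hτT : ∀ ω ∈ T, q * (r * a ω + (1 - r) * b ω) + (1 - q) * (r * b ω + (1 - r) * d ω) ≤ τ ω)
    (hτ : ∀ ω ∉ T, r * b ω + (1 - r) * d ω ≤ τ ω) :
    ∫ ω, X ω ∂μ ≤ ∫ ω, τ ω ∂μ := by
  classical
  have hS : MeasurableSet[m'] (T ∩ I) := (hm _ hT).inter hI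
  have hT0 : MeasurableSet T := hm' _ (hm _ hT)
  have hI0 : MeasurableSet I := hm' _ hI
  -- `v` bounds `X` without using `J`, and `w ≥ 0` is what `J` gains on top, so `X ≤ v - 1_J w`. As
  -- `w` is known at `m'`, `1_J` can be replaced by `r`.
  set v : Ω → ℝ := fun ω => d ω - (T ∩ I).indicator (fun ω => d ω - b ω) ω with hv
  set w : Ω → ℝ := fun ω => (d ω - b ω) +
    (T ∩ I).indicator (fun ω => (b ω - a ω) - (d ω - b ω)) ω with hw
  -- After that replacement the bound is `z - 1_I y`, with `y ≥ 0` known at `m`, so `1_I` can be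
  -- replaced by `q` in the same way.
  set z : Ω → ℝ := fun ω => r * b ω + (1 - r) * d ω with hz
  set y : Ω → ℝ := T.indicator fun ω => z ω - (r * a ω + (1 - r) * b ω) with hy
  have hvi : Integrable v μ := hdi.sub ((hdi.sub hbi).indicator (hm' _ hS))
  have hwi : Integrable w μ :=
    (hdi.sub hbi).add (((hbi.sub hai).sub (hdi.sub hbi)).indicator (hm' _ hS))
  have hzi : Integrable z μ := (hbi.const_mul r).add (hdi.const_mul (1 - r))
  have hyi : Integrable y μ :=
    (hzi.sub ((hai.const_mul r).add (hbi.const_mul (1 - r)))).indicator hT0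
  have hwm : StronglyMeasurable[m'] w :=
    ((hd.sub hb).mono hm).add ((((hb.sub ha).sub (hd.sub hb)).mono hm).indicator hS)
  have hym : StronglyMeasurable[m] y :=
    (((hb.const_mul r).add (hd.const_mul (1 - r))).sub
      ((ha.const_mul r).add (hb.const_mul (1 - r)))).indicator hT
  have hw0 (ω) : 0 ≤ w ω := by
    have := hab ω
    have := hbd ω
    by_cases h : ω ∈ T ∩ I
    · simp only [hw, Set.indicator_of_mem h]
      linarith
    · simp only [hw, Set.indicator_of_notMem h]
      linarith
  have hy0 (ω) : 0 ≤ y ω := by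
    refine Set.indicator_nonneg (fun ω _ => ?_) ω
    have h1 := mul_le_mul_of_nonneg_left (hab ω) hr0
    have h2 := mul_le_mul_of_nonneg_left (hbd ω) (sub_nonneg.2 hr1)
    simp only [hz]
    linarith
  have h1 := mul_integral_le_setIntegral hm' hwm hw0 hwi hJ hr
  have h2 := mul_integral_le_setIntegral (hm.trans hm') hym hy0 hyi hI0 hq
  have h3 : ∫ ω, X ω ∂μ ≤ ∫ ω, (v ω - J.indicator w ω) ∂μ := by
    refine integral_mono hXi (hvi.sub (hwi.indicator hJ)) fun ω => ?_
    by_cases hω : ω ∈ T ∩ I <;> by_cases hω' : ω ∈ J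
    · have := hXa ω hω hω'
      simp only [hv, hw, Set.indicator_of_mem hω, Set.indicator_of_mem hω']
      linarith
    · have := hXb ω (.inl hω)
      simp only [hv, Set.indicator_of_mem hω, Set.indicator_of_notMem hω']
      linarith
    · have := hXb ω (.inr hω')
      simp only [hv, hw, Set.indicator_of_notMem hω, Set.indicator_of_mem hω']
      linarith
    · have := hXd ω
      simp only [hv, Set.indicator_of_notMem hω, Set.indicator_of_notMem hω']
      linarith
  have h4 : ∫ ω, (v ω - r * w ω) ∂μ = ∫ ω, (z ω - I.indicator y ω) ∂μ := by
    congr 1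
    ext ω
    by_cases hω : ω ∈ T <;> by_cases hω' : ω ∈ I <;> simp [hv, hw, hz, hy, hω, hω'] <;> ring
  have h5 : ∫ ω, (z ω - q * y ω) ∂μ ≤ ∫ ω, τ ω ∂μ := by
    refine integral_mono (hzi.sub (hyi.const_mul q)) hτi fun ω => ?_
    by_cases hω : ω ∈ T
    · refine le_trans (le_of_eq ?_) (hτT ω hω)
      simp [hy, hω, hz]
      ring
    · simpa [hy, hω, hz] using hτ ω hω
  rw [integral_sub hvi (hwi.indicator hJ)] at h3
  rw [integral_sub hvi (hwi.const_mul r), integral_sub hzi (hyi.indicator hI0),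
    integral_const_mul] at h4
  rw [integral_sub hzi (hyi.const_mul q), integral_const_mul] at h5
  linarith

/-- The walk that moves up on the events `A k` and down otherwise. -/
noncomputable def walk (A : ℕ → Set Ω) (K : ℕ) (ω : Ω) : ℝ :=
  ∑ k ∈ Finset.range K, (2 * (A k).indicator (fun _ => 1) ω - 1)

lemma walk_succ (A : ℕ → Set Ω) (K : ℕ) (ω : Ω) :
    walk A (K + 1) ω = walk A K ω + (2 * (A K).indicator (fun _ => 1) ω - 1) :=
  Finset.sum_range_succ _ _

/-- A walk with conditionally nonnegative drift is unbounded above. -/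
lemma ae_not_bddAbove_walk (ℱ : Filtration ℕ mΩ) {A : ℕ → Set Ω}
    (hA : ∀ k, MeasurableSet[ℱ (k + 1)] (A k)) (h : ∀ k, ∀ᵐ ω ∂μ, 1 / 2 ≤ (μ⟦A k|ℱ k⟧) ω) :
    ∀ᵐ ω ∂μ, ¬ BddAbove (Set.range fun K => walk A K ω) := by
  have hAi (k) : Integrable ((A k).indicator fun _ => (1 : ℝ)) μ :=
    integrable_indicator_one (ℱ.le _ _ (hA k))
  have hdiff (k) (ω) : |walk A (k + 1) ω - walk A k ω| = 1 := by
    rw [walk_succ, add_sub_cancel_left]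
    by_cases hω : ω ∈ A k <;> simp [hω]
    norm_num
  have hsub : Submartingale (walk A) ℱ μ := by
    refine submartingale_of_condExp_sub_nonneg_nat (fun K => ?_) (fun K => ?_) fun k => ?_
    · have : StronglyMeasurable[ℱ K] (fun ω => walk A K ω) := by
        unfold walk
        refine Finset.stronglyMeasurable_fun_sum _ fun k hk => ?_
        have hk' : k + 1 ≤ K := Finset.mem_range.1 hk
        exact (((stronglyMeasurable_const.indicator (ℱ.mono hk' _ (hA k))).const_mul 2).sub
          stronglyMeasurable_const)
      exact this
    · exact integrable_finsetSum _ fun k _ => ((hAi k).const_mul 2).sub (integrable_const 1)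
    · have e : walk A (k + 1) - walk A k =
          (2 : ℝ) • (A k).indicator (fun _ => (1 : ℝ)) - fun _ => (1 : ℝ) := by
        ext ω
        simp [walk_succ]
      rw [e]
      have h1 := condExp_sub (m := ℱ k) ((hAi k).smul (2 : ℝ)) (integrable_const (μ := μ) (1 : ℝ))
      have h2 := condExp_smul (2 : ℝ) ((A k).indicator fun _ => (1 : ℝ)) (ℱ k) (μ := μ)
      filter_upwards [h1, h2, h k] with ω h1 h2 h
      rw [h1, Pi.sub_apply, h2, condExp_const (ℱ.le k)]
      simp only [Pi.smul_apply, smul_eq_mul, Pi.zero_apply]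
      linarith
  -- A submartingale with bounded increments almost surely converges wherever it is bounded above,
  -- which steps of length 1 exclude.
  filter_upwards [hsub.bddAbove_iff_exists_tendsto (R := 1)
    (Eventually.of_forall fun ω k => by rw [hdiff]; simp)] with ω hω hb
  obtain ⟨c, hc⟩ := hω.1 hb
  have h1 := ((hc.comp (tendsto_add_atTop_nat 1)).sub hc).abs
  simp only [Function.comp_def, hdiff, sub_self, abs_zero] at h1
  exact one_ne_zero (tendsto_nhds_unique tendsto_const_nhds h1)

/-- A radius that grows by `γ` on the events `A k`, shrinks by at most `γ` otherwise and stays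
bounded bounds the walk from above. -/
lemma bddAbove_walk_of_radius {A : ℕ → Set Ω} {δ : ℕ → ℝ} {γ : ℝ} {ω : Ω} (hγ : 1 < γ)
    (hδ : ∀ k, 0 < δ k) (hδ' : ∀ k, γ⁻¹ * δ k ≤ δ (k + 1))
    (hA : ∀ᶠ k in atTop, ω ∈ A k → γ * δ k ≤ δ (k + 1)) {B : ℝ} (hB : ∀ k, δ k ≤ B) :
    BddAbove (Set.range fun K => walk A K ω) := by
  obtain ⟨K, hK⟩ := eventually_atTop.1 hA
  have hl : 0 < Real.log γ := Real.log_pos hγ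
  have hγ0 : 0 < γ := by linarith
  -- From `K` on, `log (δ k)` gains at least `log γ` times the increment of the walk.
  have key (k : ℕ) (hk : K ≤ k) : walk A k ω * Real.log γ - Real.log (δ k) ≤
      walk A K ω * Real.log γ - Real.log (δ K) := by
    induction k, hk using Nat.le_induction with
    | base => exact le_rfl
    | succ k hk ih =>
      refine le_trans ?_ ih
      rw [walk_succ]
      by_cases hω : ω ∈ A k
      · have := Real.log_le_log (mul_pos hγ0 (hδ k)) (hK k hk hω)
        rw [Real.log_mul hγ0.ne' (hδ k).ne'] at this
        simp only [Set.indicator_of_mem hω]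
        linarith
      · have := Real.log_le_log (mul_pos (inv_pos.2 hγ0) (hδ k)) (hδ' k)
        rw [Real.log_mul (inv_pos.2 hγ0).ne' (hδ k).ne', Real.log_inv] at this
        simp only [Set.indicator_of_notMem hω]
        linarith
  refine IsBoundedUnder.bddAbove_range
    ⟨(walk A K ω * Real.log γ - Real.log (δ K) + Real.log B) / Real.log γ, ?_⟩
  rw [eventually_map]
  filter_upwards [eventually_ge_atTop K] with k hk
  rw [le_div_iff₀ hl]
  linarith [key k hk, Real.log_le_log (hδ k) (hB k)]

end Probability

/-! ### Behaviour of the algorithm along a single realization. -/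

variable {Ω : Type*} {n p : ℕ}

/-- The deterministic part of the assumptions on the algorithm, in the form in which it is used. -/
structure Setting [MeasurableSpace Ω] (f : E n → ℝ) (P : Params n) (D : Inputs n p Ω)
    (N : Seminorm ℝ (Matrix (Fin p) (Fin p) ℝ)) (κfcd κh κef κeg εf Qmax ζ ν : ℝ) (Lg : ℝ≥0) :
    Prop where
  contDiff : ContDiff ℝ 1 f
  run : IsRun P N κfcd D
  κfcd_pos : 0 < κfcd
  κef_pos : 0 < κef
  κeg_pos : 0 < κeg
  ζ_pos : 0 < ζ
  ν_pos : 0 < ν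
  ν_lt_one : ν < 1
  Qmax_pos : 0 < Qmax
  one_le_κh : 1 ≤ κh
  norm_app_le : ∀ k ω s, ‖app (D.Q k ω) s‖ ≤ Qmax * ‖s‖
  hessian_le : ∀ k ω, N (D.model k ω).H ≤ κh
  lipschitz : LipschitzOnWith Lg (gradient f) (region P D)
  εf_le : εf ≤ κef
  ζ_ge_η₂ : κeg + P.η₂ ≤ ζ
  ζ_ge_κh : κeg + κh ≤ ζ
  ζ_ge_κef : κeg + 8 * κef / (κfcd * (1 - P.η₁)) ≤ ζ
  C₁_ge : 8 * P.γ ^ 2 * (1 - ν) ≤ ν * (ζ * C₁ κfcd κh κef κeg)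
  C₂_ge : 8 * P.γ ^ 2 * (1 - ν) ≤ ν * C₂ P.η₁ P.η₂ κfcd κh εf

/-- The gradient of the objective projected to the current subspace. -/
noncomputable def projGrad (f : E n → ℝ) (P : Params n) (D : Inputs n p Ω) (k : ℕ) (ω : Ω) : E p :=
  app (D.Q k ω).transpose (gradient f (iter P D k ω))

/-- The model is accurate at the iterate, up to first order, and at the trial point. -/
def accurateModel (f : E n → ℝ) (κef κeg : ℝ) (P : Params n) (D : Inputs n p Ω) (k : ℕ) : Set Ω :=
  {ω | |f (iter P D k ω) - (D.model k ω).eval 0| ≤ κef * radius P D k ω ^ 2 ∧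
    |f (iter P D k ω + app (D.Q k ω) (D.step k ω)) - (D.model k ω).eval (D.step k ω)| ≤
      κef * radius P D k ω ^ 2 ∧
    ‖projGrad f P D k ω - (D.model k ω).g‖ ≤ κeg * radius P D k ω}

/-- The projected gradient is large relative to the radius. -/
def largeGradient (f : E n → ℝ) (ζ : ℝ) (P : Params n) (D : Inputs n p Ω) (k : ℕ) : Set Ω :=
  {ω | ζ * radius P D k ω ≤ ‖projGrad f P D k ω‖}

/-- The merit function. -/
noncomputable def merit (f : E n → ℝ) (ν : ℝ) (P : Params n) (D : Inputs n p Ω) (k : ℕ) (ω : Ω) :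
    ℝ :=
  ν * f (iter P D k ω) + (1 - ν) * radius P D k ω ^ 2

/-- The norm of the projected gradient, truncated from below. -/
noncomputable def truncGrad (f : E n → ℝ) (ζ : ℝ) (P : Params n) (D : Inputs n p Ω) (k : ℕ)
    (ω : Ω) : ℝ :=
  max ‖projGrad f P D k ω‖ (ζ * radius P D k ω)

/-- At the origin the quadratic term has zero derivative, so the Hessian plays no role. -/
lemma QuadModel.gradient_eval_zero (M : QuadModel p) : gradient M.eval 0 = M.g := by
  refine HasGradientAt.gradient ?_
  rw [hasGradientAt_iff_hasFDerivAt]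
  have h1 : HasFDerivAt (fun s : E p => (inner ℝ M.g s : ℝ)) (innerSL ℝ M.g) 0 :=
    (innerSL ℝ M.g).hasFDerivAt
  have h2 : HasFDerivAt (fun s : E p => app M.H s)
      (LinearMap.toContinuousLinearMap (Matrix.toEuclideanLin M.H)) 0 :=
    (LinearMap.toContinuousLinearMap (Matrix.toEuclideanLin M.H)).hasFDerivAt
  have h3 := (h1.const_add M.c).add ((hasFDerivAt_id (0 : E p)).inner ℝ h2)
  refine h3.congr_fderiv ?_
  ext s
  simp [fderivInnerCLM_apply]

section Deterministic

variable {f : E n → ℝ} {P : Params n} {D : Inputs n p Ω}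
  {N : Seminorm ℝ (Matrix (Fin p) (Fin p) ℝ)} {κfcd κh κef κeg εf Qmax ζ ν : ℝ} {Lg : ℝ≥0}
  {k : ℕ} {ω : Ω}

lemma Params.δmax_pos (P : Params n) : 0 < P.δmax :=
  mul_pos (pow_pos (by linarith [P.one_lt_γ]) _) P.δ₀_pos

lemma radius_pos (P : Params n) (D : Inputs n p Ω) (k : ℕ) (ω : Ω) : 0 < radius P D k ω := by
  have hγ : 0 < P.γ := by linarith [P.one_lt_γ]
  induction k with
  | zero => exact P.δ₀_pos
  | succ k ih =>
    change 0 < (state P D (k + 1) ω).2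
    change 0 < (state P D k ω).2 at ih
    rw [state]
    split_ifs
    · exact lt_min (mul_pos hγ ih) P.δmax_pos
    · exact mul_pos (inv_pos.2 hγ) ih

lemma radius_le_δmax (P : Params n) (D : Inputs n p Ω) (k : ℕ) (ω : Ω) :
    radius P D k ω ≤ P.δmax := by
  have hγ := P.one_lt_γ
  induction k with
  | zero => exact le_mul_of_one_le_left P.δ₀_pos.le (one_le_pow₀ hγ.le)
  | succ k ih =>
    change (state P D (k + 1) ω).2 ≤ _
    have h0 : 0 < (state P D k ω).2 := radius_pos P D k ω
    change (state P D k ω).2 ≤ _ at ih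
    rw [state]
    split_ifs
    · exact min_le_right _ _
    · exact (mul_le_of_le_one_left h0.le (inv_le_one_of_one_le₀ hγ.le)).trans ih

/-- Iteration `k` is successful. -/
def IsSuccessful (P : Params n) (D : Inputs n p Ω) (k : ℕ) (ω : Ω) : Prop :=
  P.η₁ ≤ D.ρ k ω ∧ P.η₂ * radius P D k ω ≤ ‖(D.model k ω).g‖

lemma iter_succ_of_successful (h : IsSuccessful P D k ω) :
    iter P D (k + 1) ω = iter P D k ω + app (D.Q k ω) (D.step k ω) :=
  congrArg Prod.fst (if_pos h)

lemma radius_succ_of_successful (h : IsSuccessful P D k ω) :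
    radius P D (k + 1) ω = min (P.γ * radius P D k ω) P.δmax :=
  congrArg Prod.snd (if_pos h)

lemma iter_succ_of_not_successful (h : ¬ IsSuccessful P D k ω) :
    iter P D (k + 1) ω = iter P D k ω := by
  have : state P D (k + 1) ω = (iter P D k ω, P.γ⁻¹ * radius P D k ω) := if_neg h
  rw [iter, this]

lemma radius_succ_of_not_successful (h : ¬ IsSuccessful P D k ω) :
    radius P D (k + 1) ω = P.γ⁻¹ * radius P D k ω :=
  congrArg Prod.snd (if_neg h)

lemma inv_mul_radius_le (P : Params n) (D : Inputs n p Ω) (k : ℕ) (ω : Ω) :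
    P.γ⁻¹ * radius P D k ω ≤ radius P D (k + 1) ω := by
  have hγ := P.one_lt_γ
  by_cases h : IsSuccessful P D k ω
  · rw [radius_succ_of_successful h]
    have h0 := radius_pos P D k ω
    have h1 : P.γ⁻¹ * radius P D k ω ≤ radius P D k ω :=
      mul_le_of_le_one_left h0.le (inv_le_one_of_one_le₀ hγ.le)
    exact le_min (h1.trans (le_mul_of_one_le_left h0.le hγ.le))
      (h1.trans (radius_le_δmax P D k ω))
  · rw [radius_succ_of_not_successful h]

/-- Full linearity is used only at `0` and at the trial step. Keeping just these points gives an
event cut out by finitely many comparisons of random variables, hence visibly measurable. -/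
lemma goodModel_subset_accurateModel (hs : ∀ ω, ‖D.step k ω‖ ≤ radius P D k ω) :
    goodModel f κef κeg P D k ⊆ accurateModel f κef κeg P D k := by
  intro ω hω
  have h0 := hω 0 (by simpa using (radius_pos P D k ω).le)
  rw [QuadModel.gradient_eval_zero, app, map_zero, add_zero] at h0
  exact ⟨h0.1, (hω _ (hs ω)).1, h0.2⟩

lemma truncGrad_eq (h : ω ∈ largeGradient f ζ P D k) :
    truncGrad f ζ P D k ω = ‖projGrad f P D k ω‖ := max_eq_left h

lemma truncGrad_eq_of_notMem (h : ω ∉ largeGradient f ζ P D k) :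
    truncGrad f ζ P D k ω = ζ * radius P D k ω := max_eq_right (not_le.1 h).le

/-- Model accuracy costs `κeg * δ`. Each lower bound imposed on `ζ` has the form `κeg + c ≤ ζ`, with
`c` being `η₂`, `κh` or the ratio threshold. -/
lemma modelGrad_ge (hT : ω ∈ largeGradient f ζ P D k) (hI : ω ∈ accurateModel f κef κeg P D k)
    {c : ℝ} (hc : κeg + c ≤ ζ) : c * radius P D k ω ≤ ‖(D.model k ω).g‖ := by
  have h1 := norm_sub_norm_le (projGrad f P D k ω) (D.model k ω).g
  have h2 := hI.2.2
  have h3 : ζ * radius P D k ω ≤ ‖projGrad f P D k ω‖ := hT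
  have h4 := mul_le_mul_of_nonneg_right hc (radius_pos P D k ω).le
  linarith

lemma merit_sub_of_not_successful (h : ¬ IsSuccessful P D k ω) :
    merit f ν P D (k + 1) ω - merit f ν P D k ω = driftFail ν P.γ (radius P D k ω) := by
  unfold merit driftFail
  rw [iter_succ_of_not_successful h, radius_succ_of_not_successful h, mul_pow, inv_pow]
  ring

lemma truncGrad_nonneg (k : ℕ) (ω : Ω) : 0 ≤ truncGrad f ζ P D k ω :=
  (norm_nonneg _).trans (le_max_left _ _)

namespace Setting

variable [MeasurableSpace Ω] (hS : Setting f P D N κfcd κh κef κeg εf Qmax ζ ν Lg)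
include hS

lemma cauchy_decrease (k : ℕ) (ω : Ω) :
    κfcd / 2 * ‖(D.model k ω).g‖ *
        min (radius P D k ω) (‖(D.model k ω).g‖ / max (N (D.model k ω).H) 1) ≤
      (D.model k ω).eval 0 - (D.model k ω).eval (D.step k ω) := hS.run.cauchy_decrease k ω

lemma C₁_pos : 0 < C₁ κfcd κh κef κeg :=
  STARS.C₁_pos hS.κfcd_pos (by linarith [hS.one_le_κh]) hS.κeg_pos

lemma C₃_pos : 0 < C₃ Lg Qmax ζ := STARS.C₃_pos Lg.coe_nonneg hS.ζ_pos

lemma max_hessian_le (k : ℕ) (ω : Ω) : max (N (D.model k ω).H) 1 ≤ κh :=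
  max_le (hS.hessian_le k ω) hS.one_le_κh

lemma isSuccessful_of_accurate (hT : ω ∈ largeGradient f ζ P D k)
    (hI : ω ∈ accurateModel f κef κeg P D k) (hJ : ω ∈ goodEstimates f εf P D k) :
    IsSuccessful P D k ω :=
  ⟨ratio_ge_of_accurate hS.κfcd_pos (radius_pos P D k ω) (le_max_right _ _)
    (hS.max_hessian_le k ω) (hS.cauchy_decrease k ω) (modelGrad_ge hT hI hS.ζ_ge_κh)
    P.η₁_lt_one (modelGrad_ge hT hI hS.ζ_ge_κef) hS.εf_le hI.1 hI.2.1 hJ.1 hJ.2,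
    modelGrad_ge hT hI hS.ζ_ge_η₂⟩

lemma sub_le_of_accurateModel (hT : ω ∈ largeGradient f ζ P D k)
    (hI : ω ∈ accurateModel f κef κeg P D k) :
    f (iter P D k ω + app (D.Q k ω) (D.step k ω)) - f (iter P D k ω) ≤
      -C₁ κfcd κh κef κeg * truncGrad f ζ P D k ω * radius P D k ω := by
  rw [truncGrad_eq hT, neg_mul, neg_mul]
  have h1 := norm_sub_norm_le (projGrad f P D k ω) (D.model k ω).g
  have h2 := hI.2.2
  have hη : κfcd * (1 - P.η₁) ≤ κfcd :=
    mul_le_of_le_one_right hS.κfcd_pos.le (by linarith [P.η₁_pos])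
  have hη' : 0 < κfcd * (1 - P.η₁) := mul_pos hS.κfcd_pos (by linarith [P.η₁_lt_one])
  have h3 : 8 * κef / κfcd ≤ 8 * κef / (κfcd * (1 - P.η₁)) := by
    have := hS.κef_pos
    gcongr
  exact objective_decrease_of_model hS.κfcd_pos (radius_pos P D k ω) (le_max_right _ _)
    (hS.max_hessian_le k ω) hS.κef_pos hS.κeg_pos (hS.cauchy_decrease k ω) hS.ζ_ge_κh
    (by linarith [hS.ζ_ge_κef]) hT (by linarith) hI.1 hI.2.1

lemma sub_le_of_goodEstimates (hJ : ω ∈ goodEstimates f εf P D k) (h : IsSuccessful P D k ω) :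
    f (iter P D k ω + app (D.Q k ω) (D.step k ω)) - f (iter P D k ω) ≤
      -(C₂ P.η₁ P.η₂ κfcd κh εf * radius P D k ω ^ 2) :=
  objective_decrease_of_estimates hS.κfcd_pos (radius_pos P D k ω) (le_max_right _ _)
    (hS.max_hessian_le k ω) (hS.cauchy_decrease k ω) P.η₁_pos P.η₂_pos h.1 h.2 hJ.1 hJ.2

lemma norm_trial_le (k : ℕ) (ω : Ω) :
    ‖app (D.Q k ω) (D.step k ω)‖ ≤ Qmax * radius P D k ω :=
  (hS.norm_app_le k ω _).trans (mul_le_mul_of_nonneg_left (hS.run.step_le k ω) hS.Qmax_pos.le)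

/-- The worst case, with no accuracy assumed. Truncating at `ζ * δ` allows the second-order term in
`δ ^ 2` to be absorbed into `G * δ`. -/
lemma sub_le (k : ℕ) (ω : Ω) :
    f (iter P D k ω + app (D.Q k ω) (D.step k ω)) - f (iter P D k ω) ≤
      C₃ Lg Qmax ζ * truncGrad f ζ P D k ω * radius P D k ω := by
  have hδ := radius_pos P D k ω
  have hs := hS.run.step_le k ω
  have h1 := sub_le_of_lipschitz_gradient (hS.contDiff.differentiable one_ne_zero) hS.lipschitz
    (x := iter P D k ω) (d := app (D.Q k ω) (D.step k ω)) fun t ht => by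
      refine ⟨ω, k, t • D.step k ω, ?_, by rw [app, app, map_smul]⟩
      rw [norm_smul, Real.norm_of_nonneg ht.1]
      exact (mul_le_of_le_one_left (norm_nonneg _) ht.2).trans
        (hs.trans (radius_le_δmax P D k ω))
  rw [inner_app_left] at h1
  have h2 : inner ℝ (projGrad f P D k ω) (D.step k ω) ≤
      truncGrad f ζ P D k ω * radius P D k ω :=
    (real_inner_le_norm _ _).trans 
      (mul_le_mul (le_max_left _ _) hs (norm_nonneg _) (truncGrad_nonneg k ω))
  have h3 : (Lg : ℝ) * ‖app (D.Q k ω) (D.step k ω)‖ ^ 2 ≤ Lg * (Qmax * radius P D k ω) ^ 2 := by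
    gcongr
    exact hS.norm_trial_le k ω
  have hζ := hS.ζ_pos
  have h4 : ζ * radius P D k ω ≤ truncGrad f ζ P D k ω := le_max_right _ _
  have h5 : Lg * (Qmax * radius P D k ω) ^ 2 ≤
      3 * Lg / (2 * ζ) * Qmax ^ 2 * (truncGrad f ζ P D k ω * radius P D k ω) := by
    have h6 : 3 * Lg / (2 * ζ) * Qmax ^ 2 * (ζ * radius P D k ω * radius P D k ω) ≤
        3 * Lg / (2 * ζ) * Qmax ^ 2 * (truncGrad f ζ P D k ω * radius P D k ω) := by gcongr
    have h7 : 3 * Lg / (2 * ζ) * Qmax ^ 2 * (ζ * radius P D k ω * radius P D k ω) =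
        3 / 2 * (Lg * (Qmax * radius P D k ω) ^ 2) := by
      field_simp
    have h8 : 0 ≤ (Lg : ℝ) * (Qmax * radius P D k ω) ^ 2 := by positivity
    linarith
  unfold C₃
  unfold projGrad at h2
  linarith

lemma merit_sub_of_successful (h : IsSuccessful P D k ω) :
    merit f ν P D (k + 1) ω - merit f ν P D k ω ≤
      ν * (f (iter P D k ω + app (D.Q k ω) (D.step k ω)) - f (iter P D k ω)) +
        (1 - ν) * (P.γ ^ 2 - 1) * radius P D k ω ^ 2 := by
  have h1 : radius P D (k + 1) ω ^ 2 ≤ (P.γ * radius P D k ω) ^ 2 := by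
    have h0 := (radius_pos P D (k + 1) ω).le
    gcongr
    rw [radius_succ_of_successful h]
    exact min_le_left _ _
  have h2 := mul_le_mul_of_nonneg_left h1 (sub_nonneg.2 hS.ν_lt_one.le)
  unfold merit
  rw [iter_succ_of_successful h]
  linarith

lemma driftFail_le (k : ℕ) (ω : Ω) : driftFail ν P.γ (radius P D k ω) ≤
    driftSuccess ν P.γ (C₃ Lg Qmax ζ) (truncGrad f ζ P D k ω) (radius P D k ω) :=
  driftFail_le_driftSuccess hS.ν_pos hS.ν_lt_one P.one_lt_γ hS.C₃_pos.le (radius_pos P D k ω).le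
    (truncGrad_nonneg k ω)

/-- Since `G ≥ ζ * δ`, a decrease `C₁ * G * δ` is at least `ζ * C₁ * δ ^ 2`, enough to outweigh
radius growth by the choice of `ν`. -/
lemma le_driftFail (k : ℕ) (ω : Ω) :
    driftSuccess ν P.γ (-C₁ κfcd κh κef κeg) (truncGrad f ζ P D k ω) (radius P D k ω) ≤
      driftFail ν P.γ (radius P D k ω) := by
  refine success_le_driftFail hS.ν_lt_one P.one_lt_γ hS.C₁_ge ?_ hS.ν_pos
  have h1 : ζ * radius P D k ω ≤ truncGrad f ζ P D k ω := le_max_right _ _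
  have h2 := mul_le_mul_of_nonneg_left
    (mul_le_mul_of_nonneg_right h1 (radius_pos P D k ω).le) hS.C₁_pos.le
  linarith

lemma merit_sub_le (k : ℕ) (ω : Ω) : merit f ν P D (k + 1) ω - merit f ν P D k ω ≤
    driftSuccess ν P.γ (C₃ Lg Qmax ζ) (truncGrad f ζ P D k ω) (radius P D k ω) := by
  by_cases h : IsSuccessful P D k ω
  · refine (hS.merit_sub_of_successful h).trans ?_
    have := mul_le_mul_of_nonneg_left (hS.sub_le k ω) hS.ν_pos.le
    unfold driftSuccess
    linarith
  · exact (merit_sub_of_not_successful h).trans_le (hS.driftFail_le k ω)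

/-- A rejected step gives equality. An accepted one decreases `f` enough through `C₁` if the model
is accurate, or through `C₂` if the estimates are. -/
lemma merit_sub_le_driftFail
    (h : ω ∈ largeGradient f ζ P D k ∩ accurateModel f κef κeg P D k ∨
      ω ∈ goodEstimates f εf P D k) :
    merit f ν P D (k + 1) ω - merit f ν P D k ω ≤ driftFail ν P.γ (radius P D k ω) := by
  by_cases hs : IsSuccessful P D k ω
  · refine (hS.merit_sub_of_successful hs).trans ?_
    rcases h with h | h
    · refine le_trans ?_ (hS.le_driftFail k ω)
      have := mul_le_mul_of_nonneg_left (hS.sub_le_of_accurateModel h.1 h.2) hS.ν_pos.le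
      unfold driftSuccess
      linarith
    · exact success_le_driftFail hS.ν_lt_one P.one_lt_γ hS.C₂_ge
        (hS.sub_le_of_goodEstimates h hs) hS.ν_pos
  · exact (merit_sub_of_not_successful hs).le

lemma merit_sub_le_driftSuccess
    (h : ω ∈ largeGradient f ζ P D k ∩ accurateModel f κef κeg P D k)
    (hJ : ω ∈ goodEstimates f εf P D k) :
    merit f ν P D (k + 1) ω - merit f ν P D k ω ≤
      driftSuccess ν P.γ (-C₁ κfcd κh κef κeg) (truncGrad f ζ P D k ω) (radius P D k ω) := by
  refine (hS.merit_sub_of_successful (hS.isSuccessful_of_accurate h.1 h.2 hJ)).trans ?_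
  have := mul_le_mul_of_nonneg_left (hS.sub_le_of_accurateModel h.1 h.2) hS.ν_pos.le
  unfold driftSuccess
  linarith

/-- For fixed `k` all realizations of the iterate lie in one deterministic ball; compactness then
makes continuous functions of it bounded, hence integrable. -/
lemma norm_iter_sub_le (k : ℕ) (ω : Ω) : ‖iter P D k ω - P.x₀‖ ≤ k * (Qmax * P.δmax) := by
  induction k with
  | zero => simp [iter, state]
  | succ k ih =>
    have h0 : 0 ≤ Qmax * P.δmax := mul_nonneg hS.Qmax_pos.le P.δmax_pos.le
    push_cast
    by_cases h : IsSuccessful P D k ω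
    · rw [iter_succ_of_successful h, add_sub_right_comm]
      refine (norm_add_le _ _).trans ?_
      have := (hS.norm_trial_le k ω).trans
        (mul_le_mul_of_nonneg_left (radius_le_δmax P D k ω) hS.Qmax_pos.le)
      linarith
    · rw [iter_succ_of_not_successful h]
      linarith

lemma exists_bound (g : E n → ℝ) (hg : Continuous g) (k : ℕ) :
    ∃ M, ∀ ω, |g (iter P D k ω)| ≤ M := by
  obtain ⟨M, hM⟩ := (isCompact_closedBall P.x₀ (k * (Qmax * P.δmax))).exists_bound_of_continuousOn
    hg.continuousOn
  exact ⟨M, fun ω => hM _ (mem_closedBall_iff_norm.2 (hS.norm_iter_sub_le k ω))⟩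

lemma norm_projGrad_le (k : ℕ) (ω : Ω) :
    ‖projGrad f P D k ω‖ ≤ Qmax * ‖gradient f (iter P D k ω)‖ :=
  norm_app_transpose_le hS.Qmax_pos.le (hS.norm_app_le k ω) _

end Setting

end Deterministic

/-- The current matrix is well aligned with the gradient of the objective. -/
def wellAligned {Ω : Type*} {n p : ℕ} (f : E n → ℝ) (αQ : ℝ) (P : Params n) (D : Inputs n p Ω)
    (k : ℕ) : Set Ω :=
  {ω | αQ * ‖gradient f (iter P D k ω)‖ ≤ ‖projGrad f P D k ω‖}

/-! ### Measurability of the events of one iteration. -/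

section MeasurableEvents

variable {Ω : Type*} {m : MeasurableSpace Ω} {n p : ℕ} {f : E n → ℝ} {P : Params n}
  {D : Inputs n p Ω} {κef κeg εf ζ : ℝ} {k : ℕ}

lemma measurable_projGrad (hf : ContDiff ℝ 1 f) (hst : Measurable[m] (state P D k))
    (hQ : Measurable[m] (D.Q k)) : Measurable[m] (projGrad f P D k) :=
  measurable_app (measurable_transpose hQ) ((continuous_gradient hf).measurable.comp hst.fst)

lemma measurable_truncGrad (hf : ContDiff ℝ 1 f) (hst : Measurable[m] (state P D k))
    (hQ : Measurable[m] (D.Q k)) : Measurable[m] (truncGrad f ζ P D k) :=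
  (measurable_projGrad hf hst hQ).norm.max (hst.snd.const_mul ζ)

lemma measurableSet_largeGradient (hf : ContDiff ℝ 1 f) (hst : Measurable[m] (state P D k))
    (hQ : Measurable[m] (D.Q k)) : MeasurableSet[m] (largeGradient f ζ P D k) :=
  measurableSet_le (hst.snd.const_mul ζ) (measurable_projGrad hf hst hQ).norm

lemma measurableSet_wellAligned {αQ : ℝ} (hf : ContDiff ℝ 1 f)
    (hst : Measurable[m] (state P D k)) (hQ : Measurable[m] (D.Q k)) :
    MeasurableSet[m] (wellAligned f αQ P D k) :=
  measurableSet_le (((continuous_gradient hf).measurable.comp hst.fst).norm.const_mul αQ)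
    (measurable_projGrad hf hst hQ).norm

lemma measurableSet_accurateModel (hf : ContDiff ℝ 1 f) (hst : Measurable[m] (state P D k))
    (hQ : Measurable[m] (D.Q k)) (hM : Measurable[m] (D.model k)) (hs : Measurable[m] (D.step k)) :
    MeasurableSet[m] (accurateModel f κef κeg P D k) := by
  have hδ := (hst.snd.pow_const 2).const_mul κef
  have h0 := (hf.continuous.measurable.comp hst.fst).sub
    (QuadModel.measurable_eval hM (measurable_const (a := (0 : E p))))
  have h1 := (hf.continuous.measurable.comp (hst.fst.add (measurable_app hQ hs))).sub
    (QuadModel.measurable_eval hM hs)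
  have h2 := (measurable_projGrad hf hst hQ).sub (QuadModel.measurable_g hM)
  exact (measurableSet_le h0.norm hδ).inter
    ((measurableSet_le h1.norm hδ).inter (measurableSet_le h2.norm (hst.snd.const_mul κeg)))

lemma measurableSet_goodEstimates (hf : ContDiff ℝ 1 f) (hst : Measurable[m] (state P D k))
    (hQ : Measurable[m] (D.Q k)) (hs : Measurable[m] (D.step k)) (h0 : Measurable[m] (D.f0 k))
    (h1 : Measurable[m] (D.fs k)) : MeasurableSet[m] (goodEstimates f εf P D k) := by
  have hδ := (hst.snd.pow_const 2).const_mul εf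
  exact (measurableSet_le (h0.sub (hf.continuous.measurable.comp hst.fst)).norm hδ).inter
    (measurableSet_le (h1.sub (hf.continuous.measurable.comp
      (hst.fst.add (measurable_app hQ hs)))).norm hδ)

end MeasurableEvents

/-! ### Expected decrease, vanishing radii, and the contradiction with the walk. -/

namespace Setting

variable {Ω : Type*} [mΩ : MeasurableSpace Ω] {μ : Measure Ω} [IsProbabilityMeasure μ] {n p : ℕ}
  {f : E n → ℝ} {P : Params n} {D : Inputs n p Ω}
  {N : Seminorm ℝ (Matrix (Fin p) (Fin p) ℝ)} {κfcd κh κef κeg εf Qmax ζ ν : ℝ} {Lg : ℝ≥0}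
  (hS : Setting f P D N κfcd κh κef κeg εf Qmax ζ ν Lg)
include hS

lemma pastMQ_le (k : ℕ) : D.pastMQ k ≤ mΩ :=
  (pastMQ_le_past_succ D k).trans (past_le hS.run (k + 1))

lemma measurable_state_pastQ (k : ℕ) : Measurable[D.pastQ k] (state P D k) :=
  (measurable_state hS.run k).mono (past_le_pastQ D k) le_rfl

lemma measurable_state_pastMQ (k : ℕ) : Measurable[D.pastMQ k] (state P D k) :=
  (hS.measurable_state_pastQ k).mono (pastQ_le_pastMQ D k) le_rfl

lemma measurableSet_accurateModel (k : ℕ) :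
    MeasurableSet[D.pastMQ k] (accurateModel f κef κeg P D k) :=
  STARS.measurableSet_accurateModel hS.contDiff (hS.measurable_state_pastMQ k)
    ((measurable_Q_pastQ D k).mono (pastQ_le_pastMQ D k) le_rfl) (measurable_model_pastMQ D k)
    (hS.run.measurable_step k)

lemma measurableSet_goodEstimates (k : ℕ) :
    MeasurableSet[D.past (k + 1)] (goodEstimates f εf P D k) :=
  STARS.measurableSet_goodEstimates hS.contDiff
    ((measurable_state hS.run k).mono (past_mono D k.le_succ) le_rfl)
    ((measurable_Q_pastQ D k).mono
      ((pastQ_le_pastMQ D k).trans (pastMQ_le_past_succ D k)) le_rfl)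
    ((hS.run.measurable_step k).mono (pastMQ_le_past_succ D k) le_rfl)
    (measurable_f0_past D k) (measurable_fs_past D k)

lemma measurable_radius (k : ℕ) : Measurable (radius P D k) :=
  ((measurable_state hS.run k).mono (past_le hS.run k) le_rfl).snd

lemma integrable_radius_sq (k : ℕ) : Integrable (fun ω => radius P D k ω ^ 2) μ := by
  refine Integrable.of_bound ((hS.measurable_radius k).pow_const 2).aestronglyMeasurable
    (P.δmax ^ 2) (Eventually.of_forall fun ω => ?_)
  have h0 := radius_pos P D k ω
  rw [Real.norm_of_nonneg (by positivity)]
  have := radius_le_δmax P D k ω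
  gcongr

lemma integrable_merit (k : ℕ) : Integrable (merit f ν P D k) μ := by
  obtain ⟨M, hM⟩ := hS.exists_bound f hS.contDiff.continuous k
  have hm := (measurable_state hS.run k).mono (past_le hS.run k) le_rfl
  have h1 : Integrable (fun ω => f (iter P D k ω)) μ :=
    Integrable.of_bound (hS.contDiff.continuous.measurable.comp hm.fst).aestronglyMeasurable M
      (Eventually.of_forall hM)
  exact (h1.const_mul ν).add ((hS.integrable_radius_sq k).const_mul (1 - ν))

lemma integrable_truncGrad_mul_radius (k : ℕ) :
    Integrable (fun ω => truncGrad f ζ P D k ω * radius P D k ω) μ := by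
  obtain ⟨M, hM⟩ := hS.exists_bound _ (continuous_gradient hS.contDiff).norm k
  have hm := (measurable_state hS.run k).mono (past_le hS.run k) le_rfl
  refine Integrable.of_bound ((measurable_truncGrad hS.contDiff hm (hS.run.measurable_Q k)).mul
    (hS.measurable_radius k)).aestronglyMeasurable
    (max (Qmax * M) (ζ * P.δmax) * P.δmax) (Eventually.of_forall fun ω => ?_)
  have h0 := radius_pos P D k ω
  have h1 := radius_le_δmax P D k ω
  have h2 := truncGrad_nonneg (f := f) (P := P) (D := D) (ζ := ζ) k ω
  have hζ := hS.ζ_pos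
  rw [Real.norm_of_nonneg (by positivity)]
  have h3 : truncGrad f ζ P D k ω ≤ max (Qmax * M) (ζ * P.δmax) := by
    refine max_le_max ((hS.norm_projGrad_le k ω).trans ?_) (by gcongr)
    exact mul_le_mul_of_nonneg_left ((le_abs_self _).trans (hM ω)) hS.Qmax_pos.le
  exact mul_le_mul h3 h1 h0.le (h2.trans h3)

lemma integrable_driftSuccess (c : ℝ) (k : ℕ) :
    Integrable (fun ω => driftSuccess ν P.γ c (truncGrad f ζ P D k ω) (radius P D k ω)) μ := by
  have h := ((hS.integrable_truncGrad_mul_radius (μ := μ) k).const_mul (ν * c)).add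
    ((hS.integrable_radius_sq (μ := μ) k).const_mul ((1 - ν) * (P.γ ^ 2 - 1)))
  refine h.congr (Eventually.of_forall fun ω => ?_)
  simp only [Pi.add_apply, driftSuccess]
  ring

lemma stronglyMeasurable_driftSuccess (c : ℝ) (k : ℕ) : StronglyMeasurable[D.pastQ k]
    (fun ω => driftSuccess ν P.γ c (truncGrad f ζ P D k ω) (radius P D k ω)) := by
  have hst := hS.measurable_state_pastQ k
  have hG : Measurable[D.pastQ k] (truncGrad f ζ P D k) :=
    measurable_truncGrad hS.contDiff hst (measurable_Q_pastQ D k)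
  exact ((((hG.const_mul c).mul hst.snd).const_mul ν).add
    ((hst.snd.pow_const 2).const_mul _)).stronglyMeasurable

lemma condProb_accurateModel {βm : ℝ} (hβm : 0 < βm) (hI : ProbFullyLinear μ f κef κeg βm P D)
    (k : ℕ) : ∀ᵐ ω ∂μ, βm ≤ (μ⟦accurateModel f κef κeg P D k|D.pastQ k⟧) ω :=
  condProb_ge_of_subset hβm (goodModel_subset_accurateModel (hS.run.step_le k))
    (hS.pastMQ_le k _ (hS.measurableSet_accurateModel k)) (hI k)

/-- Expected decrease of the merit function. -/
lemma integral_merit_succ_le {βf βm : ℝ}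
    (hβf : 0 < βf) (hβf' : βf < 1) (hβm : 0 < βm) (hβm' : βm < 1)
    (hJ : ProbAccurate μ f εf βf P D) (hI : ProbFullyLinear μ f κef κeg βm P D)
    (hβ₁ : C₃ Lg Qmax ζ / C₁ κfcd κh κef κeg ≤ (βf * βm - 1 / 2) / ((1 - βf) + (1 - βm)))
    (hβ₂ : 2 * ν * ζ * P.γ ^ 2 * C₃ Lg Qmax ζ / ((1 - ν) * (P.γ ^ 2 - 1)) + 2 * P.γ ^ 2 ≤
      βf / (1 - βf)) (k : ℕ) :
    ∫ ω, merit f ν P D (k + 1) ω ∂μ + driftRate ν P.γ βf * ∫ ω, radius P D k ω ^ 2 ∂μ ≤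
      ∫ ω, merit f ν P D k ω ∂μ := by
  have hst := hS.measurable_state_pastQ k
  have hδi := hS.integrable_radius_sq (μ := μ) k
  have hfail : Integrable (fun ω => driftFail ν P.γ (radius P D k ω)) μ :=
    (hδi.const_mul ((1 - ν) * (1 - (P.γ ^ 2)⁻¹))).neg
  have hfailm : StronglyMeasurable[D.pastQ k] fun ω => driftFail ν P.γ (radius P D k ω) :=
    ((hst.snd.pow_const 2).const_mul _).neg.stronglyMeasurable
  -- The projected gradient, and so the case distinction `T`, is known once `Q k` is drawn; model
  -- accuracy is known one stage later, before the estimates.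
  have key := integral_le_of_condProb_ge (μ := μ) (pastQ_le_pastMQ D k) (hS.pastMQ_le k)
    (T := largeGradient f ζ P D k) (I := accurateModel f κef κeg P D k)
    (J := goodEstimates f εf P D k) (q := βm) (r := βf)
    (X := fun ω => merit f ν P D (k + 1) ω - merit f ν P D k ω)
    (τ := fun ω => -(driftRate ν P.γ βf * radius P D k ω ^ 2)) hβf.le hβf'.le
    (measurableSet_largeGradient hS.contDiff hst (measurable_Q_pastQ D k))
    (hS.measurableSet_accurateModel k)
    (past_le hS.run (k + 1) _ (hS.measurableSet_goodEstimates k))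
    (hS.stronglyMeasurable_driftSuccess (-C₁ κfcd κh κef κeg) k) hfailm
    (hS.stronglyMeasurable_driftSuccess (C₃ Lg Qmax ζ) k)
    ((hS.integrable_merit (k + 1)).sub (hS.integrable_merit k))
    (hS.integrable_driftSuccess _ k) hfail (hS.integrable_driftSuccess _ k)
    (hδi.const_mul _).neg (hS.le_driftFail k) (hS.driftFail_le k) (hS.merit_sub_le k)
    (fun ω => hS.merit_sub_le_driftFail) (fun ω => hS.merit_sub_le_driftSuccess)
    (hS.condProb_accurateModel hβm hI k) (hJ k)
    (fun ω hω => by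
      rw [truncGrad_eq hω]
      exact expected_drift_large hS.ν_pos hS.ν_lt_one P.one_lt_γ hS.ζ_pos hS.C₁_pos hS.C₃_pos
        hβf hβf' hβm hβm' hS.C₁_ge hβ₁ (radius_pos P D k ω).le hω)
    (fun ω hω => by
      rw [truncGrad_eq_of_notMem hω]
      exact expected_drift_small hS.ν_pos hS.ν_lt_one P.one_lt_γ hβf' hβ₂)
  rw [integral_sub (hS.integrable_merit (k + 1)) (hS.integrable_merit k), integral_neg,
    integral_const_mul] at key
  linarith

/-- The radii tend to zero almost surely. -/
lemma ae_tendsto_radius {βf βm fmin : ℝ} (hfmin : ∀ x, fmin ≤ f x)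
    (hβf : 0 < βf) (hβf' : βf < 1) (hβm : 0 < βm) (hβm' : βm < 1)
    (hJ : ProbAccurate μ f εf βf P D) (hI : ProbFullyLinear μ f κef κeg βm P D)
    (hβ₁ : C₃ Lg Qmax ζ / C₁ κfcd κh κef κeg ≤ (βf * βm - 1 / 2) / ((1 - βf) + (1 - βm)))
    (hβ₂ : 2 * ν * ζ * P.γ ^ 2 * C₃ Lg Qmax ζ / ((1 - ν) * (P.γ ^ 2 - 1)) + 2 * P.γ ^ 2 ≤
      βf / (1 - βf)) :
    ∀ᵐ ω ∂μ, Tendsto (fun k => radius P D k ω) atTop (nhds 0) := by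
  have h := ae_tendsto_zero_of_integral_decrease (μ := μ) (c := ν * fmin)
    (driftRate_pos hS.ν_lt_one P.one_lt_γ hβf)
    (g := fun k ω => radius P D k ω ^ 2) (fun k ω => sq_nonneg _) hS.integrable_radius_sq
    (Φ := fun k => ∫ ω, merit f ν P D k ω ∂μ) (fun k => ?_)
    (hS.integral_merit_succ_le hβf hβf' hβm hβm' hJ hI hβ₁ hβ₂)
  · filter_upwards [h] with ω hω
    have := hω.sqrt
    simpa [Real.sqrt_sq (radius_pos P D _ ω).le] using this
  · have h1 : ∫ _, ν * fmin ∂μ ≤ ∫ ω, merit f ν P D k ω ∂μ := by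
      refine integral_mono (integrable_const _) (hS.integrable_merit k) fun ω => ?_
      have h2 := mul_le_mul_of_nonneg_left (hfmin (iter P D k ω)) hS.ν_pos.le
      have h3 := mul_nonneg (sub_nonneg.2 hS.ν_lt_one.le) (sq_nonneg (radius P D k ω))
      simp only [merit]
      linarith
    simpa using h1

lemma measurableSet_wellAligned (αQ : ℝ) (k : ℕ) :
    MeasurableSet[D.pastQ k] (wellAligned f αQ P D k) :=
  STARS.measurableSet_wellAligned hS.contDiff (hS.measurable_state_pastQ k)
    (measurable_Q_pastQ D k)

/-- Conditionally on the past, the iterations that are good in every respect have probability at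
least `(1 - βQ) * βm * βf`. -/
lemma condProb_good {βf βm αQ βQ : ℝ} (hβf : 0 < βf) (hβm : 0 < βm)
    (hJ : ProbAccurate μ f εf βf P D) (hI : ProbFullyLinear μ f κef κeg βm P D)
    (hA : ProbWellAligned μ αQ βQ D) (k : ℕ) :
    ∀ᵐ ω ∂μ, βf * (βm * (1 - βQ)) ≤
      (μ⟦wellAligned f αQ P D k ∩ accurateModel f κef κeg P D k ∩
        goodEstimates f εf P D k|D.past k⟧) ω := by
  have hAm := hS.measurableSet_wellAligned αQ k
  have hIm := hS.measurableSet_accurateModel k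
  -- The gradient at the iterate is determined by the past, so alignment applies to it. The model
  -- and the estimates then contribute their factors one stage at a time.
  have h1 := hA k (fun ω => gradient f (iter P D k ω))
    ((continuous_gradient hS.contDiff).measurable.comp (measurable_state hS.run k).fst)
  have h2 := mul_condProb_le_condProb_inter (μ := μ) (past_le_pastQ D k)
    ((pastQ_le_pastMQ D k).trans (hS.pastMQ_le k)) hAm (hS.pastMQ_le k _ hIm)
    (hS.condProb_accurateModel hβm hI k)
  have h3 := mul_condProb_le_condProb_inter (μ := μ)
    ((past_le_pastQ D k).trans (pastQ_le_pastMQ D k)) (hS.pastMQ_le k)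
    ((pastQ_le_pastMQ D k _ hAm).inter hIm)
    (past_le hS.run (k + 1) _ (hS.measurableSet_goodEstimates k)) (hJ k)
  filter_upwards [h1, h2, h3] with ω h1 h2 h3
  exact (mul_le_mul_of_nonneg_left ((mul_le_mul_of_nonneg_left h1 hβm.le).trans h2) hβf.le).trans
    h3

/-- If the gradients stay away from zero and the radii tend to zero, then the radii grow in all
late good iterations. -/
lemma eventually_radius_growth {αQ : ℝ} (hαQ : 0 < αQ) {ω : Ω} {c : ℝ} (hc : 0 < c)
    (hδ : Tendsto (fun k => radius P D k ω) atTop (nhds 0))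
    (hg : ∀ᶠ k in atTop, c ≤ ‖gradient f (iter P D k ω)‖) :
    ∀ᶠ k in atTop, ω ∈ wellAligned f αQ P D k ∩ accurateModel f κef κeg P D k ∩
      goodEstimates f εf P D k → P.γ * radius P D k ω ≤ radius P D (k + 1) ω := by
  have hγ : 0 < P.γ := by linarith [P.one_lt_γ]
  -- Alignment gives a projected gradient of norm at least `αQ * c`, which eventually exceeds `ζ *
  -- δ`.
  have h1 : ∀ᶠ k in atTop, ζ * radius P D k ω < αQ * c := by
    refine (hδ.const_mul ζ).eventually_lt_const ?_
    rw [mul_zero]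
    positivity
  -- The cap `δmax` is inactive for late `k`, so success means genuine growth by `γ`.
  have h2 : ∀ᶠ k in atTop, P.γ * radius P D k ω < P.δmax := by
    refine (hδ.const_mul P.γ).eventually_lt_const ?_
    rw [mul_zero]
    exact P.δmax_pos
  filter_upwards [h1, h2, hg] with k h1 h2 hg hω
  have hT : ω ∈ largeGradient f ζ P D k :=
    h1.le.trans ((mul_le_mul_of_nonneg_left hg hαQ.le).trans hω.1.1)
  rw [radius_succ_of_successful (hS.isSuccessful_of_accurate hT hω.1.2 hω.2), min_eq_left h2.le]

/-- Almost surely the gradients do not stay away from zero. -/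
lemma ae_not_eventually_le {βf βm αQ βQ : ℝ} (hβf : 0 < βf) (hβm : 0 < βm) (hαQ : 0 < αQ)
    (hβ : 1 / 2 ≤ βf * (βm * (1 - βQ)))
    (hJ : ProbAccurate μ f εf βf P D) (hI : ProbFullyLinear μ f κef κeg βm P D)
    (hA : ProbWellAligned μ αQ βQ D)
    (hδ : ∀ᵐ ω ∂μ, Tendsto (fun k => radius P D k ω) atTop (nhds 0)) :
    ∀ᵐ ω ∂μ, ∀ c > 0, ¬ ∀ᶠ k in atTop, c ≤ ‖gradient f (iter P D k ω)‖ := by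
  let ℱ : Filtration ℕ mΩ := ⟨D.past, past_mono D, past_le hS.run⟩
  have hwalk := ae_not_bddAbove_walk (μ := μ) ℱ
    (A := fun k => wellAligned f αQ P D k ∩ accurateModel f κef κeg P D k ∩
      goodEstimates f εf P D k)
    (fun k => ((pastMQ_le_past_succ D k _ ((pastQ_le_pastMQ D k _
      (hS.measurableSet_wellAligned αQ k)).inter (hS.measurableSet_accurateModel k)))).inter
        (hS.measurableSet_goodEstimates k))
    (fun k => by
      filter_upwards [hS.condProb_good hβf hβm hJ hI hA k] with ω hω using hβ.trans hω)
  -- Neither exceptional null set depends on `c`, so all `c > 0` are treated at once.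
  filter_upwards [hδ, hwalk] with ω hδ hwalk c hc hg
  exact hwalk (bddAbove_walk_of_radius P.one_lt_γ (fun k => radius_pos P D k ω)
    (fun k => inv_mul_radius_le P D k ω) (hS.eventually_radius_growth hαQ hc hδ hg)
    (fun k => radius_le_δmax P D k ω))

end Setting

/-- A nonnegative sequence that does not stay away from zero has lower limit zero. -/
lemma liminf_eq_zero_of_not_eventually_le {u : ℕ → ℝ} (h0 : ∀ k, 0 ≤ u k)
    (h : ∀ c > 0, ¬ ∀ᶠ k in atTop, c ≤ u k) :
    liminf (fun k => (u k : EReal)) atTop = 0 := by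
  refine le_antisymm (not_lt.1 fun hlt => ?_) ?_
  · obtain ⟨c, hc0, hc⟩ := EReal.lt_iff_exists_real_btwn.1 hlt
    refine h c (by exact_mod_cast hc0) ?_
    filter_upwards [eventually_lt_of_lt_liminf hc] with k hk
    exact_mod_cast hk.le
  · exact le_liminf_of_le (by isBoundedDefault)
      (Eventually.of_forall fun k => by exact_mod_cast h0 k)

end STARS

theorem mainTheorem1
    {Ω : Type*} [MeasurableSpace Ω] (μ : Measure Ω) [IsProbabilityMeasure μ]
    {n p : ℕ} (hp : 1 ≤ p) (hpn : p ≤ n)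
    -- the objective function
    (f : STARS.E n → ℝ) (hf : ContDiff ℝ 1 f) (fmin : ℝ) (hfmin : ∀ x, fmin ≤ f x)
    -- the norms used for the matrices `Q k` and for the model Hessians
    (NQ : Seminorm ℝ (Matrix (Fin n) (Fin p) ℝ)) (hNQ : STARS.IsConsistent NQ)
    (NH : Seminorm ℝ (Matrix (Fin p) (Fin p) ℝ)) (hNH : STARS.IsConsistent NH)
    -- the algorithm and its random run
    (P : STARS.Params n) (κfcd : ℝ) (hκfcd : 0 < κfcd) (hκfcd' : κfcd ≤ 1)
    (D : STARS.Inputs n p Ω) (hD : STARS.IsRun P NH κfcd D)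
    -- the matrices and the model Hessians are bounded
    (Qmax : ℝ) (hQmax : 0 < Qmax) (hQ : ∀ k ω, NQ (D.Q k ω) ≤ Qmax)
    (κh : ℝ) (hκh : 1 ≤ κh) (hH : ∀ k ω, NH (D.model k ω).H ≤ κh)
    -- `f` and its gradient are Lipschitz continuous on the region considered by the algorithm
    (Lf Lg : ℝ≥0) (hLf : LipschitzOnWith Lf f (STARS.region P D))
    (hLg : LipschitzOnWith Lg (gradient f) (STARS.region P D))
    -- probabilistic accuracy of the models and of the estimates
    (κef κeg εf : ℝ) (hκef : 0 < κef) (hκeg : 0 < κeg) (hεf : 0 < εf)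
    (hεf' : εf < min κef (1 / 4 * P.η₁ * P.η₂ * κfcd * min (P.η₂ / κh) 1))
    (βf βm : ℝ) (hβf : 0 < βf) (hβf' : βf < 1) (hβm : 0 < βm) (hβm' : βm < 1)
    (hJ : STARS.ProbAccurate μ f εf βf P D)
    (hI : STARS.ProbFullyLinear μ f κef κeg βm P D)
    -- the choice of the constants
    (ζ : ℝ) (hζ : 0 < ζ)
    (hζ' : κeg + max P.η₂ (max κh (8 * κef / (κfcd * (1 - P.η₁)))) ≤ ζ)
    (ν : ℝ) (hν : 0 < ν) (hν' : ν < 1)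
    (hν'' : 8 * P.γ ^ 2 /
        min (STARS.C₂ P.η₁ P.η₂ κfcd κh εf) (ζ * STARS.C₁ κfcd κh κef κeg) ≤ ν / (1 - ν))
    (hβ₁ : STARS.C₃ Lg Qmax ζ / STARS.C₁ κfcd κh κef κeg ≤
        (βf * βm - 1 / 2) / ((1 - βf) + (1 - βm)))
    (hβ₂ : 2 * ν * ζ * P.γ ^ 2 * STARS.C₃ Lg Qmax ζ / ((1 - ν) * (P.γ ^ 2 - 1)) + 2 * P.γ ^ 2 ≤
        βf / (1 - βf))
    -- probabilistic well alignment of the matrices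
    (αQ βQ : ℝ) (hαQ : 0 < αQ) (hαQ' : αQ < 1) (hβQ : 0 ≤ βQ)
    (hβQ' : βQ < 1 - 1 / (2 * βf * βm)) (hA : STARS.ProbWellAligned μ αQ βQ D) :
    ∀ᵐ ω ∂μ,
      liminf (fun k => ((‖gradient f (STARS.iter P D k ω)‖ : ℝ) : EReal)) atTop = 0 := by
  have hν1 : 0 < 1 - ν := by linarith
  have hη : 0 < 1 - P.η₁ := by linarith [P.η₁_lt_one]
  have hC₁ : 0 < STARS.C₁ κfcd κh κef κeg := STARS.C₁_pos hκfcd (by linarith) hκeg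
  have hC₂ : 0 < STARS.C₂ P.η₁ P.η₂ κfcd κh εf :=
    STARS.C₂_pos (hεf'.trans_le (min_le_right _ _))
  have hmin := STARS.mul_le_of_div_le_ratio hν' (lt_min hC₂ (mul_pos hζ hC₁)) hν''
  have hS : STARS.Setting f P D NH κfcd κh κef κeg εf Qmax ζ ν Lg :=
    { contDiff := hf
      run := hD
      κfcd_pos := hκfcd
      κef_pos := hκef
      κeg_pos := hκeg
      ζ_pos := hζ
      ν_pos := hν
      ν_lt_one := hν'
      Qmax_pos := hQmax
      one_le_κh := hκh
      norm_app_le := fun k ω s =>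
        (hNQ _ s).trans (mul_le_mul_of_nonneg_right (hQ k ω) (norm_nonneg s))
      hessian_le := hH
      lipschitz := hLg
      εf_le := (hεf'.trans_le (min_le_left _ _)).le
      ζ_ge_η₂ := (add_le_add_right (le_max_left _ _) _).trans hζ'
      ζ_ge_κh :=
        (add_le_add_right ((le_max_left _ _).trans (le_max_right _ _)) _).trans hζ'
      ζ_ge_κef :=
        (add_le_add_right ((le_max_right _ _).trans (le_max_right _ _)) _).trans hζ'
      C₁_ge := hmin.trans (mul_le_mul_of_nonneg_left (min_le_right _ _) hν.le)
      C₂_ge := hmin.trans (mul_le_mul_of_nonneg_left (min_le_left _ _) hν.le) }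
  -- The bound on `βQ` is exactly what keeps the drift of the walk nonnegative.
  have hβ : 1 / 2 ≤ βf * (βm * (1 - βQ)) := by
    have h1 : 1 / (2 * βf * βm) < 1 - βQ := by linarith
    rw [div_lt_iff₀ (by positivity)] at h1
    linarith
  have hδ := hS.ae_tendsto_radius hfmin hβf hβf' hβm hβm' hJ hI hβ₁ hβ₂
  filter_upwards [hS.ae_not_eventually_le hβf hβm hαQ hβ hJ hI hA hδ] with ω hω
  exact STARS.liminf_eq_zero_of_not_eventually_le (fun k => norm_nonneg _) hω
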